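/- Let $d\ge 1$ and let $(X,\varphi,\mathbb Z^d)$ be a minimal Cantor system: $X$ is a Cantor set and $\varphi$ is an action of $\mathbb Z^d$ on $X$ by homeomorphisms $\varphi^v$, $v\in\mathbb Z^d$, all of whose orbits are dense. Let $G(\varphi)=C(X,\mathbb Z)/B(\varphi)$, where $B(\varphi)$ is the subgroup generated by the functions $1_A-1_{\varphi^vA}$ with $A\subset X$ clopen and $v\in\mathbb Z^d$, and let $G(\varphi)_+=\{[f]: f(x)\ge 0 \text{ for all } x\in X\}$. For $g,h\in G(\varphi)$ write $g<h$ if $h-g\in G(\varphi)_+$ and $g\ne h$, and let $$\mathrm{Inf}(\varphi)=\{g\in G(\varphi): ng<h \text{ for all } n\in\mathbb Z \text{ and all } h\in G(\varphi)_+\setminus\{0\}\}.$$ The full group of $\varphi$ consists of the homeomorphisms $\pi:X\to X$ such that for every $x\in X$ there is $v\in\mathbb Z^d$ with $\pi(x)=\varphi^v(x)$. **Theorem.** Let $A,B\subset X$ be clopen sets with $[1_A]-[1_B]\in\mathrm{Inf}(\varphi)$, and let $x_0\in A$ and $y_0=\varphi^w(x_0)\in B$ for some $w\in\mathbb Z^d$.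 Then there is an element $\pi$ of the full group of $\varphi$ with $\pi(A)=B$ and $\pi(x_0)=y_0$, together with a function $\zeta:X\to\mathbb Z^d$ (unique if $\varphi$ is free) satisfying $\pi(x)=\varphi^{\zeta(x)}(x)$ for all $x\in X$, such that $\zeta$ is continuous on $A\setminus\{x_0\}$. -/

import Mathlib

namespace CantorSystem

open TopologicalSpace

/-- A Cantor set: a topological space homeomorphic to `{0,1}^ℕ`. -/
def IsCantorSet (X : Type*) [TopologicalSpace X] : Prop :=
  Nonempty (X ≃ₜ (ℕ → Bool))

section OrderedGroup

variable {G : Type*} [AddCommGroup G]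

/-- `g₁ ≤ g₂` in the ordered group `(G, G₊)`: the difference `g₂ - g₁` lies in `G₊`. -/
def OrdLE (Gpos : Set G) (g₁ g₂ : G) : Prop := g₂ - g₁ ∈ Gpos

/-- `g₁ < g₂` in the ordered group `(G, G₊)`: `g₁ ≤ g₂` and `g₁ ≠ g₂`. -/
def OrdLT (Gpos : Set G) (g₁ g₂ : G) : Prop := OrdLE Gpos g₁ g₂ ∧ g₁ ≠ g₂

/-- `Inf(G)`: the elements `g` with `n g < h` for all `n ∈ ℤ` and all `h ∈ G₊ \ {0}`. -/
def infinitesimals (Gpos : Set G) : Set G :=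
  {g | ∀ n : ℤ, ∀ h ∈ Gpos \ {0}, OrdLT Gpos (n • g) h}

end OrderedGroup

section Dynamics

variable {X : Type*} [TopologicalSpace X]

/-- The indicator function `1_A ∈ C(X, ℤ)` of a clopen set `A`. -/
noncomputable def ind (A : Clopens X) : C(X, ℤ) where
  toFun := (A : Set X).indicator 1
  continuous_toFun := A.isClopen.continuous_indicator continuous_one

variable (d : ℕ) [AddAction (Fin d → ℤ) X] [ContinuousConstVAdd (Fin d → ℤ) X]

/-- The clopen set `φ^v A`, where `φ^v x = v +ᵥ x`. -/
def translate {d : ℕ} [AddAction (Fin d → ℤ) X] [ContinuousConstVAdd (Fin d → ℤ) X]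
    (v : Fin d → ℤ) (A : Clopens X) : Clopens X where
  carrier := (fun x => v +ᵥ x) '' (A : Set X)
  isClopen' := ⟨(Homeomorph.vadd v).isClosedMap _ A.isClopen.1,
    (Homeomorph.vadd v).isOpenMap _ A.isClopen.2⟩

variable (X)

/-- The group `B(φ)` of coboundaries, generated by the functions `1_A - 1_{φ^v A}`
with `A` clopen and `v ∈ ℤ^d`. -/
def coboundaries : AddSubgroup C(X, ℤ) :=
  AddSubgroup.closure
    {f | ∃ (A : Clopens X) (v : Fin d → ℤ), f = ind A - ind (translate v A)}

/-- The group `G(φ) = C(X, ℤ) / B(φ)`. -/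
abbrev G : Type _ := C(X, ℤ) ⧸ coboundaries X d

/-- The positive cone `G(φ)₊`: the classes of the nonnegative functions. -/
def Gpos : Set (G X d) :=
  {g | ∃ f : C(X, ℤ), (∀ x, 0 ≤ f x) ∧ (QuotientAddGroup.mk f : G X d) = g}

/-- `Inf(φ)`, the infinitesimals of the ordered group `(G(φ), G(φ)₊)`. -/
def Inf : Set (G X d) := infinitesimals (Gpos X d)

variable {X}

/-- The class `[1_A]` in `G(φ)` of the indicator function of a clopen set `A`. -/
noncomputable def cls (A : Clopens X) : G X d := QuotientAddGroup.mk (ind A)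

end Dynamics

/-- The full group of the action: the homeomorphisms `π` of `X` such that every `π x` is of the
form `φ^v x` with `v ∈ ℤ^d` (depending on `x`). -/
def fullGroup (X : Type*) [TopologicalSpace X] (d : ℕ) [AddAction (Fin d → ℤ) X] :
    Set (X ≃ₜ X) :=
  {π | ∀ x, ∃ v : Fin d → ℤ, π x = v +ᵥ x}

end CantorSystem

/-! Box averages of coboundaries tend to 0 uniformly. Testing an infinitesimal against the class of
the constant 1 therefore shows that 1_A - 1_B has uniformly vanishing box averages
(`sub_mem_meanNull_of_mem_Inf`). From then on only this `meanNull` condition is used.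

The core is a comparison theorem, `exists_injOn_of_box_count_lt`. An excess of B over A in every
translate of one box makes finite subsets of A expand into B. Hall's theorem turns expansion into
local rematchings that absorb an unmatched point. Performing them clopenly lowers the number of
unmatched points by a fixed factor per round, and geometric decay beats the polynomial growth of
boxes, so finitely many rounds match all of A.

Nonempty open sets have frequency bounded below, and every point has clopen neighbourhoods of
arbitrarily small frequency. Hence, after removing a clopen piece from A, the rest embeds in B off a
small neighbourhood of y₀. Alternating the two sides gives clopen sets shrinking to x₀ and y₀ whose
successive differences are equidecomposable. Gluing these pieces and sending x₀ to y₀ gives a map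
continuous everywhere on A, with a cocycle that can jump only at x₀. The complements are treated in
the same way.

Freeness is not needed: the group is abelian and the action minimal, so all points have the same
stabilizer (`stabilizer_eq`). -/

namespace CantorSystem

open Filter Topology Set

/-! ### Boxes in ℤ^d and their polynomial growth. -/

section Box

variable {d : ℕ}

/-- The box `[-n, n]^d` in `ℤ^d`. -/
noncomputable def box (d n : ℕ) : Finset (Fin d → ℤ) :=
  Fintype.piFinset fun _ => Finset.Icc (-(n : ℤ)) n

theorem mem_box {n : ℕ} {v : Fin d → ℤ} : v ∈ box d n ↔ ∀ i, -(n : ℤ) ≤ v i ∧ v i ≤ n := by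
  simp [box]

theorem card_box (n : ℕ) : (box d n).card = (2 * n + 1) ^ d := by
  rw [box, Fintype.card_piFinset_const, Int.card_Icc]
  congr 1
  omega

theorem card_box_pos (n : ℕ) : 0 < (box d n).card := by
  rw [card_box]; positivity

theorem zero_mem_box (n : ℕ) : (0 : Fin d → ℤ) ∈ box d n := by
  rw [mem_box]; intro i; simp

theorem add_mem_box {m n : ℕ} {u v : Fin d → ℤ} (hu : u ∈ box d m) (hv : v ∈ box d n) :
    u + v ∈ box d (m + n) := by
  rw [mem_box] at *
  intro i
  have := hu i
  have := hv i
  simp only [Pi.add_apply]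
  push_cast
  omega

theorem neg_mem_box {n : ℕ} {v : Fin d → ℤ} (hv : v ∈ box d n) : -v ∈ box d n := by
  rw [mem_box] at *
  intro i
  have := hv i
  simp only [Pi.neg_apply]
  omega

theorem box_mono {m n : ℕ} (h : m ≤ n) : box d m ⊆ box d n := by
  intro v hv
  rw [mem_box] at *
  intro i
  have := hv i
  omega

theorem exists_mem_box (v : Fin d → ℤ) : ∃ n, v ∈ box d n := by
  refine ⟨∑ i, (v i).natAbs, mem_box.2 fun i => ?_⟩
  have : (v i).natAbs ≤ ∑ i, (v i).natAbs :=
    Finset.single_le_sum (f := fun i => (v i).natAbs) (fun _ _ => Nat.zero_le _) (Finset.mem_univ i)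
  omega

theorem exists_subset_box (s : Finset (Fin d → ℤ)) : ∃ n, s ⊆ box d n := by
  choose f hf using exists_mem_box (d := d)
  exact ⟨s.sup f, fun v hv => box_mono (Finset.le_sup hv) (hf v)⟩

/-- Exponential growth beats the polynomial growth of boxes. -/
theorem exists_pow_mul_card_box_lt (d q L : ℕ) :
    ∃ m : ℕ, q ^ m * (box d (m * L)).card < (q + 1) ^ m := by
  have hr : |(q : ℝ) / (q + 1)| < 1 := by
    rw [abs_of_nonneg (by positivity), div_lt_one (by positivity)]
    linarith
  have h := (tendsto_pow_const_mul_const_pow_of_abs_lt_one d hr).const_mul ((2 * (L : ℝ) + 1) ^ d)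
  rw [mul_zero] at h
  obtain ⟨m, hm, hm1⟩ := ((h.eventually_lt_const one_pos).and (eventually_ge_atTop 1)).exists
  refine ⟨m, ?_⟩
  rw [card_box]
  have hq : (0 : ℝ) < (q + 1) ^ m := by positivity
  rw [div_pow, ← mul_assoc, ← mul_div_assoc, div_lt_one hq] at hm
  have h1 : ((2 * (m * L) + 1 : ℕ) : ℝ) ^ d ≤ (2 * (L : ℝ) + 1) ^ d * m ^ d := by
    rw [← mul_pow]
    gcongr
    have : (1 : ℝ) ≤ m := by exact_mod_cast hm1
    push_cast
    nlinarith
  have : ((q ^ m * (2 * (m * L) + 1) ^ d : ℕ) : ℝ) < ((q + 1) ^ m : ℕ) := by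
    push_cast at h1 ⊢
    calc (q : ℝ) ^ m * (2 * (m * L) + 1) ^ d ≤ q ^ m * ((2 * (L : ℝ) + 1) ^ d * m ^ d) := by gcongr
      _ = (2 * (L : ℝ) + 1) ^ d * m ^ d * q ^ m := by ring
      _ < _ := hm
  exact_mod_cast this

end Box

/-! ### Expansion and rematching through Hall's theorem. -/

section Matching

variable {X : Type*} {d : ℕ} [AddAction (Fin d → ℤ) X]

open Classical in
/-- The points of the orbit of `x` at distance at most `n` from `x`. -/
noncomputable def ball (d n : ℕ) [AddAction (Fin d → ℤ) X] (x : X) : Finset X :=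
  (box d n).image fun v => v +ᵥ x

theorem mem_ball {n : ℕ} {x z : X} : z ∈ ball d n x ↔ ∃ v ∈ box d n, v +ᵥ x = z := by
  classical
  simp [ball]

theorem card_ball_le (n : ℕ) (x : X) : (ball d n x).card ≤ (box d n).card := by
  classical
  exact Finset.card_image_le

theorem mem_ball_self (n : ℕ) (x : X) : x ∈ ball d n x :=
  mem_ball.2 ⟨0, zero_mem_box n, zero_vadd _ x⟩

theorem mem_ball_comm {n : ℕ} {x z : X} : z ∈ ball d n x ↔ x ∈ ball d n z := by
  constructor <;>
  · intro h
    obtain ⟨v, hv, rfl⟩ := mem_ball.1 h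
    exact mem_ball.2 ⟨-v, neg_mem_box hv, neg_vadd_vadd v _⟩

theorem mem_ball_trans {m n : ℕ} {x y z : X} (h : z ∈ ball d m y) (h' : y ∈ ball d n x) :
    z ∈ ball d (m + n) x := by
  obtain ⟨v, hv, rfl⟩ := mem_ball.1 h
  obtain ⟨u, hu, rfl⟩ := mem_ball.1 h'
  exact mem_ball.2 ⟨v + u, add_mem_box hv hu, add_vadd v u x⟩

theorem ball_mono {m n : ℕ} (h : m ≤ n) (x : X) : ball d m x ⊆ ball d n x := by
  intro z hz
  obtain ⟨v, hv, rfl⟩ := mem_ball.1 hz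
  exact mem_ball.2 ⟨v, box_mono h hv, rfl⟩

open Classical in
/-- If every translate of a box meets `B` more often than `A`, then finite subsets of `A` expand
uniformly into `B`. -/
theorem card_expansion {A B : Set X} {N : ℕ}
    (h : ∀ y : X, ((box d N).filter fun v => v +ᵥ y ∈ A).card + 1 ≤
      ((box d N).filter fun v => v +ᵥ y ∈ B).card)
    (S : Finset X) (hS : ∀ z ∈ S, z ∈ A) :
    ((box d N).card + 1) * S.card ≤
      (box d N).card * ((S.biUnion (ball d (N + N))).filter (· ∈ B)).card := by
  set F := box d N with hF
  set Y := S.biUnion (ball d N) with hY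
  set T := (S.biUnion (ball d (N + N))).filter (· ∈ B) with hT
  have hSY : S ⊆ Y := fun z hz => Finset.mem_biUnion.2 ⟨z, hz, mem_ball_self N z⟩
  -- Double counting of pairs (y, v) in Y × F. For each v, at least |S| points y have v +ᵥ y in A
  -- and at most |T| have it in B. The excess of 1 for each y in Y ⊇ S gives the extra |S|.
  have key : ∀ C : Set X, ∑ y ∈ Y, (F.filter fun v => v +ᵥ y ∈ C).card =
      ∑ v ∈ F, (Y.filter fun y => v +ᵥ y ∈ C).card := by
    intro C
    simp only [Finset.card_filter]
    exact Finset.sum_comm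
  have h1 : ∑ y ∈ Y, ((F.filter fun v => v +ᵥ y ∈ A).card + 1) ≤
      ∑ y ∈ Y, (F.filter fun v => v +ᵥ y ∈ B).card := Finset.sum_le_sum fun y _ => h y
  rw [Finset.sum_add_distrib, key, key] at h1
  have h2 : F.card * S.card ≤ ∑ v ∈ F, (Y.filter fun y => v +ᵥ y ∈ A).card := by
    rw [← smul_eq_mul, ← Finset.sum_const]
    refine Finset.sum_le_sum fun v hv => ?_
    refine Finset.card_le_card_of_injOn (fun s => -v +ᵥ s) (fun s hs => ?_)
      ((AddAction.injective (-v)).injOn)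
    simp only [Finset.coe_filter, mem_ofPred_eq, vadd_neg_vadd]
    exact ⟨Finset.mem_biUnion.2 ⟨s, hs, mem_ball.2 ⟨-v, neg_mem_box hv, rfl⟩⟩, hS s hs⟩
  have h3 : ∑ v ∈ F, (Y.filter fun y => v +ᵥ y ∈ B).card ≤ F.card * T.card := by
    rw [← smul_eq_mul, ← Finset.sum_const]
    refine Finset.sum_le_sum fun v hv => ?_
    refine Finset.card_le_card_of_injOn (fun s => v +ᵥ s) (fun y hy => ?_)
      ((AddAction.injective v).injOn)
    simp only [Finset.coe_filter, mem_ofPred_eq] at hy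
    obtain ⟨s, hs, hys⟩ := Finset.mem_biUnion.1 hy.1
    refine Finset.mem_coe.2 (Finset.mem_filter.2 ⟨Finset.mem_biUnion.2 ⟨s, hs, ?_⟩, hy.2⟩)
    exact mem_ball_trans (mem_ball.2 ⟨v, hv, rfl⟩) hys
  have h4 : S.card ≤ ∑ y ∈ Y, 1 := by
    simpa using Finset.card_le_card hSY
  nlinarith

/-- `σ` describes a partial injection from `A` to `B` moving each point `x` with `σ x = some g`
to `g +ᵥ x`, where `g` ranges over the box of size `R`. -/
structure IsMatching [TopologicalSpace X] (A B : Set X) (R : ℕ) (σ : X → Option (Fin d → ℤ)) :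
    Prop where
  isLocallyConstant : IsLocallyConstant σ
  mem_left : ∀ {x g}, σ x = some g → x ∈ A
  mem_right : ∀ {x g}, σ x = some g → g +ᵥ x ∈ B
  mem_box : ∀ {x g}, σ x = some g → g ∈ box d R
  inj : ∀ {x y g h}, σ x = some g → σ y = some h → g +ᵥ x = h +ᵥ y → x = y

/-- A rematching of the matched points near an unmatched point `x` of `A` which also
matches `x`. -/
theorem IsMatching.exists_rematch [TopologicalSpace X] {A B : Set X} {R q K : ℕ}
    {σ : X → Option (Fin d → ℤ)} (hσ : IsMatching A B R σ)
    (hexp : open Classical in ∀ S : Finset X, (∀ z ∈ S, z ∈ A) →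
      (q + 1) * S.card ≤ q * ((S.biUnion (ball d R)).filter (· ∈ B)).card)
    (hK : q ^ K * (box d (K * (R + R))).card < (q + 1) ^ K)
    {x : X} (hxA : x ∈ A) (hx : σ x = none) :
    ∃ (S : Finset X) (p : X → (Fin d → ℤ)), S ⊆ ball d (K * (R + R)) x ∧ x ∈ S ∧
      (∀ z ∈ S, z ∈ A ∧ p z ∈ box d R ∧ p z +ᵥ z ∈ B) ∧
      (∀ z ∈ S, ∀ z' ∈ S, p z +ᵥ z = p z' +ᵥ z' → z = z') ∧
      (∀ z ∈ S, ∀ z' g, σ z' = some g → g +ᵥ z' = p z +ᵥ z → z' ∈ S) := by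
  classical
  set r := K * (R + R) with hr
  set S : Finset X := (ball d r x).filter fun z => σ z ≠ none ∨ z = x with hS
  have hSA : ∀ z ∈ S, z ∈ A := by
    intro z hz
    rcases (Finset.mem_filter.1 hz).2 with h | rfl
    · obtain ⟨g, hg⟩ := Option.ne_none_iff_exists'.1 h
      exact hσ.mem_left hg
    · exact hxA
  have hxS : x ∈ S := Finset.mem_filter.2 ⟨mem_ball_self r x, Or.inr rfl⟩
  set m : X → X := fun z => (σ z).getD 0 +ᵥ z with hm
  have hm' : ∀ z g, σ z = some g → m z = g +ᵥ z := by
    intro z g hg; simp [hm, hg]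
  -- Admissible targets are those not occupied by a matched point outside S, so rematching S cannot
  -- disturb the rest.
  set t : S → Finset X := fun z => (ball d R (z : X)).filter fun b =>
    b ∈ B ∧ ∀ z' g, σ z' = some g → g +ᵥ z' = b → z' ∈ S with ht
  have hmt : ∀ z : S, (z : X) ≠ x → m z ∈ t z := by
    intro z hz
    have h := (Finset.mem_filter.1 z.2).2.resolve_right hz
    obtain ⟨g, hg⟩ := Option.ne_none_iff_exists'.1 h
    rw [hm' _ _ hg]
    refine Finset.mem_filter.2 ⟨mem_ball.2 ⟨g, hσ.mem_box hg, rfl⟩, hσ.mem_right hg, ?_⟩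
    intro z' g' hz' he
    rw [hσ.inj hz' hg he]
    exact z.2
  have hminj : ∀ z ∈ S, ∀ z' ∈ S, z ≠ x → z' ≠ x → m z = m z' → z = z' := by
    intro z hz z' hz' hzx hzx' he
    have h := (Finset.mem_filter.1 hz).2.resolve_right hzx
    obtain ⟨g, hg⟩ := Option.ne_none_iff_exists'.1 h
    have h' := (Finset.mem_filter.1 hz').2.resolve_right hzx'
    obtain ⟨g', hg'⟩ := Option.ne_none_iff_exists'.1 h'
    rw [hm' _ _ hg, hm' _ _ hg'] at he
    exact hσ.inj hg hg' he
  have hall : ∀ s : Finset S, s.card ≤ (s.biUnion t).card := by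
    intro s
    set x' : S := ⟨x, hxS⟩ with hx'
    have hsub : (s.erase x').image (fun z : S => m z) ⊆ s.biUnion t := by
      intro b hb
      obtain ⟨z, hz, rfl⟩ := Finset.mem_image.1 hb
      obtain ⟨hz1, hz2⟩ := Finset.mem_erase.1 hz
      exact Finset.mem_biUnion.2 ⟨z, hz2, hmt z fun h => hz1 (Subtype.ext h)⟩
    have hcard : ((s.erase x').image (fun z : S => m z)).card = (s.erase x').card := by
      refine Finset.card_image_of_injOn fun z hz z' hz' he => ?_
      have hz1 := (Finset.mem_erase.1 hz).1
      have hz1' := (Finset.mem_erase.1 hz').1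
      exact Subtype.ext (hminj z z.2 z' z'.2 (fun h => hz1 (Subtype.ext h))
        (fun h => hz1' (Subtype.ext h)) he)
    by_contra hlt
    push Not at hlt
    have hxs : x' ∈ s := by
      by_contra hxs
      rw [Finset.erase_eq_of_notMem hxs] at hcard hsub
      have := Finset.card_le_card hsub
      omega
    -- A violation of Hall's condition leaves no target of s beyond the current partners of s
    -- without x.
    have heq : (s.erase x').image (fun z : S => m z) = s.biUnion t := by
      refine Finset.eq_of_subset_of_card_le hsub ?_
      rw [hcard, Finset.card_erase_of_mem hxs]
      omega
    set s' : ℕ → Finset X := fun k =>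
      (s.image Subtype.val).filter fun z => z ∈ ball d (k * (R + R)) x with hs'
    -- For k < K, any point occupying a neighbour of `s' k` lies within (k + 1) * (R + R) of x,
    -- hence in S. The neighbour is thus admissible, and by `heq` its partner lies in `s' (k + 1)`.
    -- Expansion makes these sets grow exponentially, against `hK`.
    have hstep : ∀ k < K, (q + 1) * (s' k).card ≤ q * (s' (k + 1)).card := by
      intro k hk
      refine (hexp (s' k) ?_).trans (Nat.mul_le_mul_left _ ?_)
      · intro z hz
        obtain ⟨w, -, rfl⟩ := Finset.mem_image.1 (Finset.mem_filter.1 hz).1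
        exact hSA _ w.2
      · refine (Finset.card_le_card ?_).trans (Finset.card_image_le (f := m))
        intro b hb
        obtain ⟨hb1, hbB⟩ := Finset.mem_filter.1 hb
        obtain ⟨z, hz, hbz⟩ := Finset.mem_biUnion.1 hb1
        obtain ⟨hz1, hzk⟩ := Finset.mem_filter.1 hz
        obtain ⟨w, hw, rfl⟩ := Finset.mem_image.1 hz1
        have hfar : ∀ z' g, σ z' = some g → g +ᵥ z' = b → z' ∈ ball d ((k + 1) * (R + R)) x := by
          intro z' g hg he
          have h1 : z' ∈ ball d R b := mem_ball_comm.1 (mem_ball.2 ⟨g, hσ.mem_box hg, he⟩)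
          have := mem_ball_trans h1 (mem_ball_trans hbz hzk)
          exact ball_mono (by ring_nf; omega) _ this
        have hbt : b ∈ t w := by
          refine Finset.mem_filter.2 ⟨hbz, hbB, fun z' g hg he => ?_⟩
          refine Finset.mem_filter.2 ⟨ball_mono ?_ _ (hfar z' g hg he), Or.inl (by simp [hg])⟩
          exact Nat.mul_le_mul_right _ hk
        have : b ∈ s.biUnion t := Finset.mem_biUnion.2 ⟨w, hw, hbt⟩
        rw [← heq] at this
        obtain ⟨y, hy, rfl⟩ := Finset.mem_image.1 this
        obtain ⟨hy1, hy2⟩ := Finset.mem_erase.1 hy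
        have h := (Finset.mem_filter.1 y.2).2.resolve_right fun h => hy1 (Subtype.ext h)
        obtain ⟨g, hg⟩ := Option.ne_none_iff_exists'.1 h
        refine Finset.mem_image.2 ⟨y, Finset.mem_filter.2 ⟨Finset.mem_image_of_mem _ hy2, ?_⟩, rfl⟩
        exact hfar y g hg (hm' _ _ hg).symm
    have hpow : ∀ k ≤ K, (q + 1) ^ k ≤ q ^ k * (s' k).card := by
      intro k
      induction k with
      | zero =>
        intro _
        have : x ∈ s' 0 :=
          Finset.mem_filter.2 ⟨Finset.mem_image.2 ⟨x', hxs, rfl⟩, mem_ball_self _ x⟩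
        simpa using Finset.card_pos.2 ⟨x, this⟩
      | succ k ih =>
        intro hk
        have h1 := ih (by omega)
        have h2 := hstep k (by omega)
        calc (q + 1) ^ (k + 1) = (q + 1) ^ k * (q + 1) := pow_succ _ _
          _ ≤ q ^ k * (s' k).card * (q + 1) := Nat.mul_le_mul_right _ h1
          _ = q ^ k * ((q + 1) * (s' k).card) := by ring
          _ ≤ q ^ k * (q * (s' (k + 1)).card) := Nat.mul_le_mul_left _ h2
          _ = _ := by ring
    have h1 := hpow K le_rfl
    have h2 : (s' K).card ≤ (box d r).card := by
      refine (Finset.card_le_card fun z hz => ?_).trans (card_ball_le r x)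
      exact (Finset.mem_filter.1 hz).2
    have h3 := Nat.mul_le_mul_left (q ^ K) h2
    omega
  obtain ⟨f, hfinj, hf⟩ := (Finset.all_card_le_biUnion_card_iff_exists_injective t).1 hall
  have hp : ∀ z : S, ∃ v ∈ box d R, v +ᵥ (z : X) = f z := fun z =>
    mem_ball.1 (Finset.mem_filter.1 (hf z)).1
  choose p hp1 hp2 using hp
  refine ⟨S, fun z => if h : z ∈ S then p ⟨z, h⟩ else 0, Finset.filter_subset _ _, hxS, ?_, ?_, ?_⟩
  · intro z hz
    simp only [hz, dif_pos]
    refine ⟨hSA z hz, hp1 _, ?_⟩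
    rw [hp2 ⟨z, hz⟩]
    exact (Finset.mem_filter.1 (hf ⟨z, hz⟩)).2.1
  · intro z hz z' hz' he
    simp only [hz, hz', dif_pos] at he
    rw [hp2 ⟨z, hz⟩, hp2 ⟨z', hz'⟩] at he
    exact congrArg Subtype.val (hfinj he)
  · intro z hz z' g hg he
    simp only [hz, dif_pos] at he
    rw [hp2 ⟨z, hz⟩] at he
    exact (Finset.mem_filter.1 (hf ⟨z, hz⟩)).2.2 z' g hg he

end Matching

/-! ### Clopen rematching and dynamical comparison. -/

section Comparison

variable {X : Type*} {d : ℕ} [TopologicalSpace X] [AddAction (Fin d → ℤ) X]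

-- Substitute for freeness: which translations coincide does not depend on the point, so a finite
-- pattern in one orbit can be copied to another.
omit [TopologicalSpace X] in
theorem vadd_eq_vadd_of_stabilizers_eq
    (hstab : ∀ (g : Fin d → ℤ) (x y : X), g +ᵥ x = x → g +ᵥ y = y)
    {g h : Fin d → ℤ} {x : X} (y : X) (e : g +ᵥ x = h +ᵥ x) : g +ᵥ y = h +ᵥ y := by
  have h1 : (-h + g) +ᵥ x = x := by rw [add_vadd, e, neg_vadd_vadd]
  have h2 := hstab _ x y h1
  rw [add_vadd] at h2
  rw [← h2, vadd_neg_vadd, h2]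

variable [ContinuousConstVAdd (Fin d → ℤ) X]

/-- A g fixing x fixes everything; any other g moves a small neighbourhood of x off itself. This
keeps patches centred at distinct points of V from colliding. -/
theorem exists_nhds_separated [T2Space X]
    (hstab : ∀ (g : Fin d → ℤ) (x y : X), g +ᵥ x = x → g +ᵥ y = y) (x : X) (L : ℕ) :
    ∃ V ∈ 𝓝 x, ∀ u ∈ V, ∀ u' ∈ V, ∀ g ∈ box d L, g +ᵥ u = u' → u = u' := by
  have h : ∀ g : Fin d → ℤ, ∃ V ∈ 𝓝 x, ∀ u ∈ V, ∀ u' ∈ V, g +ᵥ u = u' → u = u' := by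
    intro g
    by_cases hg : g +ᵥ x = x
    · exact ⟨univ, univ_mem, fun u _ u' _ e => by rw [← e, hstab g x u hg]⟩
    · obtain ⟨U, U', hU, hU', hxU, hxU', hd⟩ := t2_separation hg
      have hc : Tendsto (fun z : X => g +ᵥ z) (𝓝 x) (𝓝 (g +ᵥ x)) :=
        (continuous_const_vadd g).tendsto x
      refine ⟨U' ∩ (fun z => g +ᵥ z) ⁻¹' U,
        inter_mem (hU'.mem_nhds hxU') (hc (hU.mem_nhds hxU)), ?_⟩
      rintro u ⟨-, hu⟩ u' ⟨hu', -⟩ rfl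
      exact (disjoint_left.1 hd hu hu').elim
  choose V hV hV' using h
  refine ⟨⋂ g ∈ box d L, V g, (Filter.biInter_finset_mem _).2 fun g _ => hV g, ?_⟩
  intro u hu u' hu' g hg e
  rw [mem_iInter₂] at hu hu'
  exact hV' g u (hu g hg) u' (hu' g hg) e

theorem isClopen_preimage_vadd (g : Fin d → ℤ) {C : Set X} (hC : IsClopen C) :
    IsClopen ((fun z : X => g +ᵥ z) ⁻¹' C) :=
  hC.preimage (continuous_const_vadd g)

/-- Overwrites σ on the translates of W by H. Here `h2` makes the new value independent of the
chosen representation, `h3` gives injectivity among new values, and `h4` ensures that whoever loses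
its target is itself rematched. -/
theorem IsMatching.exists_patch {A B : Set X} {R : ℕ} {σ : X → Option (Fin d → ℤ)}
    (hσ : IsMatching A B R σ) {W : Set X} (hW : IsClopen W)
    (H : Finset (Fin d → ℤ)) (p : (Fin d → ℤ) → (Fin d → ℤ))
    (h1 : ∀ u ∈ W, ∀ h ∈ H, h +ᵥ u ∈ A ∧ p h ∈ box d R ∧ p h +ᵥ h +ᵥ u ∈ B)
    (h2 : ∀ u ∈ W, ∀ u' ∈ W, ∀ h ∈ H, ∀ h' ∈ H, h +ᵥ u = h' +ᵥ u' → p h = p h')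
    (h3 : ∀ u ∈ W, ∀ u' ∈ W, ∀ h ∈ H, ∀ h' ∈ H, p h +ᵥ h +ᵥ u = p h' +ᵥ h' +ᵥ u' →
      h +ᵥ u = h' +ᵥ u')
    (h4 : ∀ u ∈ W, ∀ h ∈ H, ∀ z g, σ z = some g → g +ᵥ z = p h +ᵥ h +ᵥ u →
      ∃ h' ∈ H, ∃ u' ∈ W, z = h' +ᵥ u') :
    ∃ σ', IsMatching A B R σ' ∧ (∀ u ∈ W, ∀ h ∈ H, σ' (h +ᵥ u) ≠ none) ∧
      ∀ z, (∀ h ∈ H, ∀ u ∈ W, z ≠ h +ᵥ u) → σ' z = σ z := by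
  classical
  set P : X → Prop := fun z => ∃ h ∈ H, ∃ u ∈ W, z = h +ᵥ u with hP
  set σ' : X → Option (Fin d → ℤ) := fun z => if hz : P z then some (p hz.choose) else σ z with hσ'
  have hon : ∀ u ∈ W, ∀ h ∈ H, σ' (h +ᵥ u) = some (p h) := by
    intro u hu h hh
    have hz : P (h +ᵥ u) := ⟨h, hh, u, hu, rfl⟩
    simp only [hσ', hz, dif_pos]
    obtain ⟨hc, u', hu', e⟩ := hz.choose_spec
    rw [h2 u hu u' hu' h hh _ hc e]
  have hoff : ∀ z, ¬ P z → σ' z = σ z := by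
    intro z hz
    simp only [hσ', hz, dif_neg, not_false_eq_true]
  have hcl : IsClosed {z | P z} := by
    have : {z | P z} = ⋃ h ∈ H, (fun z : X => -h +ᵥ z) ⁻¹' W := by
      ext z
      simp only [hP, mem_ofPred_eq, mem_iUnion, mem_preimage, exists_prop]
      refine exists_congr fun h => and_congr_right fun _ => ⟨?_, fun hz => ⟨_, hz, ?_⟩⟩
      · rintro ⟨u, hu, rfl⟩
        rwa [neg_vadd_vadd]
      · rw [vadd_neg_vadd]
    rw [this]
    exact (H.finite_toSet.isClosed_biUnion fun h _ => (isClopen_preimage_vadd (-h) hW).isClosed)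
  refine ⟨σ', ⟨?_, ?_, ?_, ?_, ?_⟩, fun u hu h hh => by simp [hon u hu h hh],
    fun z hz => hoff z ?_⟩
  · rw [IsLocallyConstant.iff_eventually_eq]
    intro z
    by_cases hz : P z
    · obtain ⟨h, hh, u, hu, rfl⟩ := hz
      have hmem : (fun z : X => -h +ᵥ z) ⁻¹' W ∈ 𝓝 (h +ᵥ u) :=
        (isClopen_preimage_vadd (-h) hW).isOpen.mem_nhds (by simpa using hu)
      filter_upwards [hmem] with y hy
      have : y = h +ᵥ (-h +ᵥ y) := by rw [vadd_neg_vadd]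
      rw [this, hon _ hy h hh, hon u hu h hh]
    · filter_upwards [hcl.isOpen_compl.mem_nhds hz,
        (IsLocallyConstant.iff_eventually_eq σ).1 hσ.isLocallyConstant z] with y hy hy'
      rw [hoff z hz, hoff y hy, hy']
  · intro z g hg
    by_cases hz : P z
    · obtain ⟨h, hh, u, hu, rfl⟩ := hz
      exact (h1 u hu h hh).1
    · exact hσ.mem_left (hoff z hz ▸ hg)
  · intro z g hg
    by_cases hz : P z
    · obtain ⟨h, hh, u, hu, rfl⟩ := hz
      obtain rfl : p h = g := Option.some_injective _ ((hon u hu h hh).symm.trans hg)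
      exact (h1 u hu h hh).2.2
    · exact hσ.mem_right (hoff z hz ▸ hg)
  · intro z g hg
    by_cases hz : P z
    · obtain ⟨h, hh, u, hu, rfl⟩ := hz
      obtain rfl : p h = g := Option.some_injective _ ((hon u hu h hh).symm.trans hg)
      exact (h1 u hu h hh).2.1
    · exact hσ.mem_box (hoff z hz ▸ hg)
  · intro z z' g g' hg hg' e
    by_cases hz : P z <;> by_cases hz' : P z'
    · obtain ⟨h, hh, u, hu, rfl⟩ := hz
      obtain ⟨h', hh', u', hu', rfl⟩ := hz'
      obtain rfl : p h = g := Option.some_injective _ ((hon u hu h hh).symm.trans hg)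
      obtain rfl : p h' = g' := Option.some_injective _ ((hon u' hu' h' hh').symm.trans hg')
      exact h3 u hu u' hu' h hh h' hh' e
    · obtain ⟨h, hh, u, hu, rfl⟩ := hz
      obtain rfl : p h = g := Option.some_injective _ ((hon u hu h hh).symm.trans hg)
      exact (hz' (h4 u hu h hh z' g' (hoff z' hz' ▸ hg') e.symm)).elim
    · obtain ⟨h', hh', u', hu', rfl⟩ := hz'
      obtain rfl : p h' = g' := Option.some_injective _ ((hon u' hu' h' hh').symm.trans hg')
      exact (hz (h4 u' hu' h' hh' z g (hoff z hz ▸ hg) e)).elim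
    · exact hσ.inj (hoff z hz ▸ hg) (hoff z' hz' ▸ hg') e
  · rintro ⟨h, hh, u, hu, e⟩
    exact hz h hh u hu e

variable [CompactSpace X] [T2Space X] [TotallyDisconnectedSpace X]

theorem exists_isClopen_mem_subset {x : X} {V : Set X} (hV : V ∈ 𝓝 x) :
    ∃ C, IsClopen C ∧ x ∈ C ∧ C ⊆ V := by
  obtain ⟨U, hUV, hU, hxU⟩ := mem_nhds_iff.1 hV
  obtain ⟨C, hC, hxC, hCU⟩ := compact_exists_isClopen_in_isOpen hU hxU
  exact ⟨C, hC, hxC, hCU.trans hUV⟩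

/-- The rematching found at x is copied to every nearby u, even for a later σ, as long as σ still
agrees with σ₀ around u. -/
theorem IsMatching.exists_patch_nhds
    (hstab : ∀ (g : Fin d → ℤ) (x y : X), g +ᵥ x = x → g +ᵥ y = y)
    {A B : Set X} (hA : IsClopen A) (hB : IsClopen B) {R q K : ℕ}
    (hexp : open Classical in ∀ S : Finset X, (∀ z ∈ S, z ∈ A) →
      (q + 1) * S.card ≤ q * ((S.biUnion (ball d R)).filter (· ∈ B)).card)
    (hK : q ^ K * (box d (K * (R + R))).card < (q + 1) ^ K)
    {σ₀ : X → Option (Fin d → ℤ)} (hσ₀ : IsMatching A B R σ₀)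
    {x : X} (hxA : x ∈ A) (hx : σ₀ x = none) :
    ∃ V, IsClopen V ∧ x ∈ V ∧ (∀ u ∈ V, u ∈ A ∧ σ₀ u = none) ∧
      ∀ σ, IsMatching A B R σ → ∀ W ⊆ V, IsClopen W →
        (∀ u ∈ W, ∀ g ∈ box d (K * (R + R) + (R + R)), σ (g +ᵥ u) = σ₀ (g +ᵥ u)) →
        ∃ σ', IsMatching A B R σ' ∧ (∀ z, σ' z = none → σ z = none) ∧
          (∀ u ∈ W, σ' u ≠ none) ∧
          ∀ z, σ' z ≠ σ z → ∃ g ∈ box d (K * (R + R)), g +ᵥ z ∈ W := by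
  classical
  obtain ⟨S, p, hSr, hxS, hS1, hS2, hS3⟩ := hσ₀.exists_rematch hexp hK hxA hx
  set r := K * (R + R) with hr
  obtain ⟨V₁, hV₁, hsep⟩ := exists_nhds_separated hstab x ((r + R) + (r + R))
  have hpat : ∀ g : Fin d → ℤ, ∀ᶠ u in 𝓝 x, σ₀ (g +ᵥ u) = σ₀ (g +ᵥ x) ∧
      (g +ᵥ x ∈ A → g +ᵥ u ∈ A) ∧ (g +ᵥ x ∈ B → g +ᵥ u ∈ B) := by
    intro g
    have hc : Tendsto (fun z : X => g +ᵥ z) (𝓝 x) (𝓝 (g +ᵥ x)) :=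
      (continuous_const_vadd g).tendsto x
    refine (hc.eventually ((IsLocallyConstant.iff_eventually_eq σ₀).1
      hσ₀.isLocallyConstant _)).and (Eventually.and ?_ ?_)
    · by_cases h : g +ᵥ x ∈ A
      · filter_upwards [hc (hA.isOpen.mem_nhds h)] with u hu _ using hu
      · exact Eventually.of_forall fun _ h' => (h h').elim
    · by_cases h : g +ᵥ x ∈ B
      · filter_upwards [hc (hB.isOpen.mem_nhds h)] with u hu _ using hu
      · exact Eventually.of_forall fun _ h' => (h h').elim
  -- Rematched points lie within r, their targets within r + R, and the previous owners of those
  -- targets within r + 2R.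
  have hpat' := (Filter.eventually_all_finset (box d (r + (R + R)))).2 fun g _ => hpat g
  obtain ⟨V, hV, hxV, hVsub⟩ := exists_isClopen_mem_subset (inter_mem hV₁ hpat')
  refine ⟨V, hV, hxV, ?_, ?_⟩
  · intro u hu
    have := (hVsub hu).2 0 (zero_mem_box _)
    simp only [zero_vadd] at this
    exact ⟨this.2.1 hxA, this.1.trans hx⟩
  intro σ hσ W hWV hW hagree
  set H := (box d r).filter fun h => h +ᵥ x ∈ S with hH
  have hHr : ∀ h ∈ H, h ∈ box d r := fun h hh => (Finset.mem_filter.1 hh).1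
  have hHS : ∀ h ∈ H, h +ᵥ x ∈ S := fun h hh => (Finset.mem_filter.1 hh).2
  have hHex : ∀ z ∈ S, ∃ h ∈ H, h +ᵥ x = z := by
    intro z hz
    obtain ⟨h, hh, e⟩ := mem_ball.1 (hSr hz)
    exact ⟨h, Finset.mem_filter.2 ⟨hh, e ▸ hz⟩, e⟩
  have hWsep : ∀ u ∈ W, ∀ u' ∈ W, ∀ g ∈ box d (r + R), ∀ g' ∈ box d (r + R),
      g +ᵥ u = g' +ᵥ u' → u = u' := by
    intro u hu u' hu' g hg g' hg' e
    refine hsep u (hVsub (hWV hu)).1 u' (hVsub (hWV hu')).1 (-g' + g)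
      (add_mem_box (neg_mem_box hg') hg) ?_
    rw [add_vadd, e, neg_vadd_vadd]
  have hph : ∀ h ∈ H, p (h +ᵥ x) + h ∈ box d (r + R) := fun h hh => by
    rw [add_comm r R]
    exact add_mem_box (hS1 _ (hHS h hh)).2.1 (hHr h hh)
  have hex : ∃ σ', IsMatching A B R σ' ∧ (∀ u ∈ W, ∀ h ∈ H, σ' (h +ᵥ u) ≠ none) ∧
      ∀ z, (∀ h ∈ H, ∀ u ∈ W, z ≠ h +ᵥ u) → σ' z = σ z := by
    refine hσ.exists_patch hW H (fun h => p (h +ᵥ x)) ?_ ?_ ?_ ?_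
    · intro u hu h hh
      obtain ⟨h1, h2, h3⟩ := hS1 _ (hHS h hh)
      refine ⟨((hVsub (hWV hu)).2 h (box_mono (by omega) (hHr h hh))).2.1 h1, h2, ?_⟩
      rw [← add_vadd] at h3 ⊢
      exact ((hVsub (hWV hu)).2 _ (box_mono (by omega) (hph h hh))).2.2 h3
    · intro u hu u' hu' h hh h' hh' e
      obtain rfl := hWsep u hu u' hu' h (box_mono (by omega) (hHr h hh)) h'
        (box_mono (by omega) (hHr h' hh')) e
      rw [vadd_eq_vadd_of_stabilizers_eq hstab x e]
    · intro u hu u' hu' h hh h' hh' e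
      simp only [← add_vadd] at e
      obtain rfl := hWsep u hu u' hu' _ (hph h hh) _ (hph h' hh') e
      have e' := vadd_eq_vadd_of_stabilizers_eq hstab x e
      rw [add_vadd, add_vadd] at e'
      exact vadd_eq_vadd_of_stabilizers_eq hstab u (hS2 _ (hHS h hh) _ (hHS h' hh') e')
    · intro u hu h hh z g hg e
      set f : Fin d → ℤ := -g + (p (h +ᵥ x) + h) with hf
      have hz : z = f +ᵥ u := by
        rw [hf, add_vadd, add_vadd, ← e, neg_vadd_vadd]
      have hfm : f ∈ box d (r + (R + R)) := by
        have := add_mem_box (neg_mem_box (hσ.mem_box hg)) (hph h hh)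
        exact box_mono (by omega) this
      have h0 : σ₀ (f +ᵥ x) = some g := by
        rw [← ((hVsub (hWV hu)).2 f hfm).1, ← hagree u hu f hfm, ← hz, hg]
      have hfS := hS3 _ (hHS h hh) (f +ᵥ x) g h0
        (by rw [hf, add_vadd, add_vadd, vadd_neg_vadd])
      obtain ⟨h', hh', e'⟩ := hHex _ hfS
      exact ⟨h', hh', u, hu, by rw [hz, vadd_eq_vadd_of_stabilizers_eq hstab u e']⟩
  obtain ⟨σ', hσ', hon, hoff⟩ := hex
  have hoff' : ∀ z, σ' z ≠ σ z → ∃ h ∈ H, ∃ u ∈ W, z = h +ᵥ u := by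
    intro z hz
    by_contra hcon
    push Not at hcon
    exact hz (hoff z fun h hh u hu => hcon h hh u hu)
  refine ⟨σ', hσ', ?_, ?_, ?_⟩
  · intro z hz
    by_contra hne
    obtain ⟨h, hh, u, hu, rfl⟩ := hoff' z fun e => hne (e ▸ hz)
    exact hon u hu h hh hz
  · intro u hu
    obtain ⟨h, hh, e⟩ := hHex x hxS
    have := hon u hu h hh
    rwa [hstab h x u e] at this
  · intro z hz
    obtain ⟨h, hh, u, hu, rfl⟩ := hoff' z hz
    exact ⟨-h, neg_mem_box (hHr h hh), by rwa [neg_vadd_vadd]⟩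

/-- Patches are made over a finite cover, one member at a time, only where σ₀ is still intact
nearby. A point stays unmatched only because of a nearby earlier change, and each change is charged
to a newly matched point. -/
theorem IsMatching.exists_improve
    (hstab : ∀ (g : Fin d → ℤ) (x y : X), g +ᵥ x = x → g +ᵥ y = y)
    {A B : Set X} (hA : IsClopen A) (hB : IsClopen B) {R q K : ℕ}
    (hexp : open Classical in ∀ S : Finset X, (∀ z ∈ S, z ∈ A) →
      (q + 1) * S.card ≤ q * ((S.biUnion (ball d R)).filter (· ∈ B)).card)
    (hK : q ^ K * (box d (K * (R + R))).card < (q + 1) ^ K)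
    {σ₀ : X → Option (Fin d → ℤ)} (hσ₀ : IsMatching A B R σ₀) :
    ∃ σ₁ : X → Option (Fin d → ℤ), IsMatching A B R σ₁ ∧ ∀ z ∈ A, σ₁ z = none → σ₀ z = none ∧
      ∃ g ∈ box d (K * (R + R) + (K * (R + R) + (R + R))),
        g +ᵥ z ∈ A ∧ σ₀ (g +ᵥ z) = none ∧ σ₁ (g +ᵥ z) ≠ none := by
  classical
  set r := K * (R + R) with hr
  set L := r + (R + R) with hL
  set U : Set X := A ∩ σ₀ ⁻¹' {none} with hU
  have hUc : IsCompact U :=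
    (hA.isClosed.inter (hσ₀.isLocallyConstant.isClosed_fiber none)).isCompact
  choose V hVcl hxV hVA hVpatch using fun x : U =>
    hσ₀.exists_patch_nhds hstab hA hB hexp hK x.2.1 x.2.2
  obtain ⟨t, ht⟩ := hUc.elim_nhds_subcover' (fun x hx => V ⟨x, hx⟩)
    fun x hx => (hVcl ⟨x, hx⟩).isOpen.mem_nhds (hxV ⟨x, hx⟩)
  have main : ∀ F : Finset U, ∃ σ : X → Option (Fin d → ℤ),
      IsMatching A B R σ ∧ (∀ z, σ z = none → σ₀ z = none) ∧
      (∀ z, σ z ≠ σ₀ z → ∃ g ∈ box d r, g +ᵥ z ∈ A ∧ σ₀ (g +ᵥ z) = none ∧ σ (g +ᵥ z) ≠ none) ∧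
      ∀ x ∈ F, ∀ u ∈ V x, σ u = none →
        ∃ g ∈ box d (r + L), g +ᵥ u ∈ A ∧ σ₀ (g +ᵥ u) = none ∧ σ (g +ᵥ u) ≠ none := by
    intro F
    induction F using Finset.induction_on with
    | empty => exact ⟨σ₀, hσ₀, fun _ h => h, fun z h => (h rfl).elim, by simp⟩
    | insert x F _ ih =>
      obtain ⟨σ, hσ, hmono, hch, hF⟩ := ih
      set W : Set X := V x ∩ ⋂ g ∈ box d L, {u | σ (g +ᵥ u) = σ₀ (g +ᵥ u)} with hW
      have hWcl : IsClopen W := by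
        refine (hVcl x).inter (Set.Finite.isClopen_biInter (box d L).finite_toSet fun g _ => ?_)
        have h1 : IsLocallyConstant fun u : X => (σ (g +ᵥ u), σ₀ (g +ᵥ u)) :=
          (hσ.isLocallyConstant.comp_continuous (continuous_const_vadd g)).prodMk
            (hσ₀.isLocallyConstant.comp_continuous (continuous_const_vadd g))
        exact ⟨⟨h1 {a | a.1 = a.2}ᶜ⟩, h1 {a | a.1 = a.2}⟩
      obtain ⟨σ', hσ', hmono', hon, hch'⟩ := hVpatch x σ hσ W inter_subset_left hWcl
        fun u hu g hg => mem_iInter₂.1 hu.2 g hg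
      have hcharge : ∀ z, σ' z ≠ σ₀ z →
          ∃ g ∈ box d r, g +ᵥ z ∈ A ∧ σ₀ (g +ᵥ z) = none ∧ σ' (g +ᵥ z) ≠ none := by
        intro z hz
        by_cases hzz : σ' z = σ z
        · obtain ⟨g, hg, h1, h2, h3⟩ := hch z (hzz ▸ hz)
          exact ⟨g, hg, h1, h2, fun h => h3 (hmono' _ h)⟩
        · obtain ⟨g, hg, hgW⟩ := hch' z hzz
          exact ⟨g, hg, (hVA x _ hgW.1).1, (hVA x _ hgW.1).2, hon _ hgW⟩
      refine ⟨σ', hσ', fun z hz => hmono z (hmono' z hz), hcharge, ?_⟩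
      intro y hy u hu hnone
      rcases Finset.mem_insert.1 hy with rfl | hy
      · have huW : u ∉ W := fun h => hon u h hnone
        have : ∃ g ∈ box d L, σ (g +ᵥ u) ≠ σ₀ (g +ᵥ u) := by
          by_contra hcon
          push Not at hcon
          exact huW ⟨hu, mem_iInter₂.2 hcon⟩
        obtain ⟨g, hg, hne⟩ := this
        obtain ⟨g', hg', h1, h2, h3⟩ := hch _ hne
        rw [← add_vadd] at h1 h2 h3
        exact ⟨g' + g, add_mem_box hg' hg, h1, h2, fun h => h3 (hmono' _ h)⟩
      · obtain ⟨g, hg, h1, h2, h3⟩ := hF y hy u hu (hmono' u hnone)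
        exact ⟨g, hg, h1, h2, fun h => h3 (hmono' _ h)⟩
  obtain ⟨σ₁, hσ₁, hmono, -, hF⟩ := main t
  refine ⟨σ₁, hσ₁, fun z hz hnone => ⟨hmono z hnone, ?_⟩⟩
  obtain ⟨x, hx, hzx⟩ := mem_iUnion₂.1 (ht ⟨hz, hmono z hnone⟩)
  exact hF x hx z hzx hnone

/-- Dynamical comparison: if every translate of some box meets `B` more often than `A`, then `A`
can be moved into `B` by a piecewise translation. -/
theorem exists_injOn_of_box_count_lt
    (hstab : ∀ (g : Fin d → ℤ) (x y : X), g +ᵥ x = x → g +ᵥ y = y)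
    {A B : Set X} (hA : IsClopen A) (hB : IsClopen B) {N : ℕ}
    (h : open Classical in ∀ y : X, ((box d N).filter fun v => v +ᵥ y ∈ A).card + 1 ≤
      ((box d N).filter fun v => v +ᵥ y ∈ B).card) :
    ∃ c : X → (Fin d → ℤ), IsLocallyConstant c ∧ MapsTo (fun x => c x +ᵥ x) A B ∧
      InjOn (fun x => c x +ᵥ x) A := by
  classical
  -- The parameter K bounds the radius of one rematching, L the distance of the charging, and m the
  -- number of rounds.
  have hexp := card_expansion h
  set q := (box d N).card with hq
  set R := N + N with hR
  obtain ⟨K, hK⟩ := exists_pow_mul_card_box_lt d q (R + R)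
  set L := K * (R + R) + (K * (R + R) + (R + R)) with hL
  set Q := (box d L).card with hQ
  obtain ⟨m, hm⟩ := exists_pow_mul_card_box_lt d Q L
  have iter : ∀ k : ℕ, ∃ σ : X → Option (Fin d → ℤ), IsMatching A B R σ ∧ ∀ (n : ℕ) (x : X),
      (Q + 1) ^ k * ((ball d n x).filter fun z => z ∈ A ∧ σ z = none).card ≤
        Q ^ k * (box d (n + k * L)).card := by
    intro k
    induction k with
    | zero =>
      refine ⟨fun _ => none, ⟨IsLocallyConstant.const _, by simp, by simp, by simp, by simp⟩, ?_⟩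
      intro n x
      simpa using (Finset.card_filter_le _ _).trans (card_ball_le n x)
    | succ k ih =>
      obtain ⟨σ₀, hσ₀, hc⟩ := ih
      obtain ⟨σ₁, hσ₁, hch⟩ := hσ₀.exists_improve hstab hA hB hexp hK
      refine ⟨σ₁, hσ₁, fun n x => ?_⟩
      set S := (ball d n x).filter fun z => z ∈ A ∧ σ₁ z = none with hS
      set T := (ball d (n + L) x).filter fun z => (z ∈ A ∧ σ₀ z = none) ∧ σ₁ z ≠ none with hT
      set Y := (ball d (n + L) x).filter fun z => z ∈ A ∧ σ₀ z = none with hY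
      have h1 : S.card ≤ Q * T.card := by
        have hsub : S ⊆ T.biUnion (ball d L) := by
          intro z hz
          obtain ⟨hzn, hzA, hz0⟩ := Finset.mem_filter.1 hz
          obtain ⟨-, g, hg, hgA, hg0, hg1⟩ := hch z hzA hz0
          have hgz : g +ᵥ z ∈ ball d L z := mem_ball.2 ⟨g, hg, rfl⟩
          refine Finset.mem_biUnion.2 ⟨g +ᵥ z, Finset.mem_filter.2 ⟨?_, ⟨hgA, hg0⟩, hg1⟩,
            mem_ball_comm.1 hgz⟩
          rw [add_comm]
          exact mem_ball_trans hgz hzn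
        refine (Finset.card_le_card hsub).trans ?_
        rw [mul_comm]
        exact Finset.card_biUnion_le_card_mul _ _ _ fun z _ => card_ball_le L z
      have h2 : S.card + T.card ≤ Y.card := by
        rw [← Finset.card_union_of_disjoint]
        · refine Finset.card_le_card (Finset.union_subset ?_ ?_)
          · intro z hz
            obtain ⟨hzn, hzA, hz0⟩ := Finset.mem_filter.1 hz
            exact Finset.mem_filter.2 ⟨ball_mono (by omega) x hzn, hzA, (hch z hzA hz0).1⟩
          · intro z hz
            obtain ⟨hzn, hzA, -⟩ := Finset.mem_filter.1 hz
            exact Finset.mem_filter.2 ⟨hzn, hzA⟩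
        · rw [Finset.disjoint_left]
          intro z hz hz'
          exact (Finset.mem_filter.1 hz').2.2 (Finset.mem_filter.1 hz).2.2
      -- Each newly matched point is charged by at most Q unmatched ones, so the unmatched count
      -- drops by the factor Q / (Q + 1), at the cost of enlarging the ball by L.
      have h3 : (Q + 1) * S.card ≤ Q * Y.card := by nlinarith
      have h4 := hc (n + L) x
      have h5 : n + L + k * L = n + (k + 1) * L := by ring
      rw [h5] at h4
      calc (Q + 1) ^ (k + 1) * S.card = (Q + 1) ^ k * ((Q + 1) * S.card) := by ring
        _ ≤ (Q + 1) ^ k * (Q * Y.card) := Nat.mul_le_mul_left _ h3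
        _ = Q * ((Q + 1) ^ k * Y.card) := by ring
        _ ≤ Q * (Q ^ k * (box d (n + (k + 1) * L)).card) := Nat.mul_le_mul_left _ h4
        _ = _ := by ring
  obtain ⟨σ, hσ, hc⟩ := iter m
  have htot : ∀ x ∈ A, σ x ≠ none := by
    intro x hx hnone
    have h1 := hc 0 x
    rw [zero_add] at h1
    have h2 : 0 < ((ball d 0 x).filter fun z => z ∈ A ∧ σ z = none).card :=
      Finset.card_pos.2 ⟨x, Finset.mem_filter.2 ⟨mem_ball_self 0 x, hx, hnone⟩⟩
    have h3 := Nat.le_mul_of_pos_right ((Q + 1) ^ m) h2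
    omega
  have hget : ∀ x ∈ A, σ x = some ((σ x).getD 0) := by
    intro x hx
    obtain ⟨g, hg⟩ := Option.ne_none_iff_exists'.1 (htot x hx)
    simp [hg]
  refine ⟨fun x => (σ x).getD 0, hσ.isLocallyConstant.comp fun o => o.getD 0, ?_, ?_⟩
  · intro x hx
    exact hσ.mem_right (hget x hx)
  · intro x hx y hy e
    exact hσ.inj (hget x hx) (hget y hy) e

end Comparison

/-! ### Uniform box averages and infinitesimals. -/

section Mean

/-- Boxes form a Følner sequence: |box (N + j)| / |box N| tends to 1. -/
theorem eventually_mul_card_box_sub_le (d k j : ℕ) :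
    ∀ᶠ N : ℕ in atTop, k * (box d (N + j)).card ≤ (k + 1) * (box d N).card := by
  rcases Nat.eq_zero_or_pos k with rfl | hk
  · simp
  have h1 : Tendsto (fun N : ℕ => (1 + 2 * (j : ℝ) / (N : ℝ)) ^ d) atTop (𝓝 ((1 + 0) ^ d)) :=
    ((tendsto_const_div_atTop_nhds_zero_nat _).const_add 1).pow d
  have hk' : (0 : ℝ) < k := by exact_mod_cast hk
  have h2 : ((1 + 0) ^ d : ℝ) < (k + 1) / k := by
    rw [add_zero, one_pow, lt_div_iff₀ hk']
    linarith
  filter_upwards [h1.eventually_lt_const h2, eventually_gt_atTop 0] with N hN hN0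
  rw [lt_div_iff₀ hk'] at hN
  have hN0' : (0 : ℝ) < N := by exact_mod_cast hN0
  have h3 : (2 * ((N : ℝ) + j) + 1) ≤ (1 + 2 * j / N) * (2 * N + 1) := by
    have : (0 : ℝ) ≤ 2 * j / N := by positivity
    have h4 : 2 * (j : ℝ) / N * N = 2 * j := by field_simp
    nlinarith
  have h5 : (2 * ((N : ℝ) + j) + 1) ^ d ≤ (1 + 2 * j / N) ^ d * (2 * N + 1) ^ d := by
    rw [← mul_pow]
    gcongr
  have h6 : (k : ℝ) * (2 * ((N : ℝ) + j) + 1) ^ d ≤ (k + 1) * (2 * N + 1) ^ d := by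
    have : (0 : ℝ) < (2 * N + 1) ^ d := by positivity
    nlinarith
  rw [card_box, card_box]
  exact_mod_cast h6

variable {X : Type*} {d : ℕ} [AddAction (Fin d → ℤ) X]

/-- The sum of `f` over a box in the orbit of `y`. -/
noncomputable def boxSum (d N : ℕ) [AddAction (Fin d → ℤ) X] (f : X → ℤ) (y : X) : ℤ :=
  ∑ v ∈ box d N, f (v +ᵥ y)

theorem boxSum_add (N : ℕ) (f g : X → ℤ) (y : X) :
    boxSum d N (f + g) y = boxSum d N f y + boxSum d N g y := by
  simp [boxSum, Finset.sum_add_distrib]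

theorem boxSum_neg (N : ℕ) (f : X → ℤ) (y : X) : boxSum d N (-f) y = -boxSum d N f y := by
  simp [boxSum]

theorem boxSum_sub (N : ℕ) (f g : X → ℤ) (y : X) :
    boxSum d N (f - g) y = boxSum d N f y - boxSum d N g y := by
  simp [boxSum]

theorem boxSum_zsmul (N : ℕ) (n : ℤ) (f : X → ℤ) (y : X) :
    boxSum d N (n • f) y = n * boxSum d N f y := by
  simp [boxSum, Finset.mul_sum]

theorem boxSum_one (N : ℕ) (y : X) : boxSum d N 1 y = (box d N).card := by
  simp [boxSum]

theorem boxSum_mono (N : ℕ) {f g : X → ℤ} (h : ∀ x, f x ≤ g x) (y : X) :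
    boxSum d N f y ≤ boxSum d N g y :=
  Finset.sum_le_sum fun _ _ => h _

theorem boxSum_nonneg (N : ℕ) {f : X → ℤ} (h : ∀ x, 0 ≤ f x) (y : X) : 0 ≤ boxSum d N f y :=
  Finset.sum_nonneg fun _ _ => h _

open Classical in
theorem boxSum_indicator (N : ℕ) (C : Set X) (y : X) :
    boxSum d N (C.indicator 1) y = ((box d N).filter fun v => v +ᵥ y ∈ C).card := by
  simp [boxSum, Set.indicator_apply, Finset.sum_boole]

/-- The functions whose averages over boxes tend to `0` uniformly. -/
def meanNull (X : Type*) (d : ℕ) [AddAction (Fin d → ℤ) X] : AddSubgroup (X → ℤ) where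
  carrier := {f | ∀ k : ℕ, ∀ᶠ N : ℕ in atTop, ∀ y : X,
    (k : ℤ) * |boxSum d N f y| ≤ (box d N).card}
  zero_mem' k := Eventually.of_forall fun N y => by simp [boxSum]
  add_mem' {f g} hf hg k := by
    filter_upwards [hf (2 * k), hg (2 * k)] with N h1 h2 y
    rw [boxSum_add]
    have h3 := h1 y
    have h4 := h2 y
    push_cast at h3 h4
    have h5 := mul_le_mul_of_nonneg_left (abs_add_le (boxSum d N f y) (boxSum d N g y))
      (Int.natCast_nonneg k)
    linarith
  neg_mem' {f} hf k := by
    filter_upwards [hf k] with N h1 y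
    rw [boxSum_neg, abs_neg]
    exact h1 y

theorem mem_meanNull {f : X → ℤ} : f ∈ meanNull X d ↔ ∀ k : ℕ, ∀ᶠ N : ℕ in atTop, ∀ y : X,
    (k : ℤ) * |boxSum d N f y| ≤ (box d N).card := Iff.rfl

/-- Only the symmetric difference of a box and its translate contributes, and it is negligible. -/
theorem comp_vadd_sub_mem_meanNull {f : X → ℤ} (hf : ∀ x, |f x| ≤ 1) (g : Fin d → ℤ) :
    (fun x => f (g +ᵥ x)) - f ∈ meanNull X d := by
  intro k
  obtain ⟨j, hj⟩ := exists_mem_box g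
  filter_upwards [eventually_mul_card_box_sub_le d (2 * k) j] with N hN y
  set s := (box d N).map (addLeftEmbedding g) with hs
  have hsum : boxSum d N (fun x => f (g +ᵥ x)) y = ∑ v ∈ s, f (v +ᵥ y) := by
    rw [hs, Finset.sum_map]
    exact Finset.sum_congr rfl fun v _ => by simp [add_vadd]
  have hb : ∀ t : Finset (Fin d → ℤ), |∑ v ∈ t, f (v +ᵥ y)| ≤ t.card := by
    intro t
    refine (Finset.abs_sum_le_sum_abs _ _).trans ?_
    simpa using Finset.sum_le_card_nsmul t (fun v => |f (v +ᵥ y)|) 1 fun v _ => hf _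
  have hc1 : (s \ box d N).card + (box d N).card ≤ (box d (N + j)).card := by
    rw [← Finset.card_union_of_disjoint Finset.sdiff_disjoint]
    refine Finset.card_le_card (Finset.union_subset ?_ (box_mono (by omega)))
    intro v hv
    obtain ⟨u, hu, rfl⟩ := Finset.mem_map.1 (Finset.mem_sdiff.1 hv).1
    rw [add_comm N j]
    exact add_mem_box hj hu
  have hc2 : (box d N \ s).card = (s \ box d N).card := by
    have h1 := Finset.card_sdiff_add_card_inter s (box d N)
    have h2 := Finset.card_sdiff_add_card_inter (box d N) s
    rw [Finset.inter_comm] at h2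
    have h3 : s.card = (box d N).card := Finset.card_map _
    omega
  rw [boxSum_sub, hsum, boxSum, ← Finset.sum_sdiff_sub_sum_sdiff]
  have h1 := hb (s \ box d N)
  have h2 := hb (box d N \ s)
  rw [hc2] at h2
  have h3 := abs_sub (∑ v ∈ s \ box d N, f (v +ᵥ y)) (∑ v ∈ box d N \ s, f (v +ᵥ y))
  have h4 : |(∑ v ∈ s \ box d N, f (v +ᵥ y)) - ∑ v ∈ box d N \ s, f (v +ᵥ y)| ≤
      2 * (s \ box d N).card := by linarith
  have h5 : 2 * k * ((s \ box d N).card + (box d N).card) ≤ (2 * k + 1) * (box d N).card :=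
    (Nat.mul_le_mul_left _ hc1).trans hN
  have h6 : k * (2 * (s \ box d N).card) ≤ (box d N).card := by nlinarith
  calc (k : ℤ) * _ ≤ k * (2 * (s \ box d N).card) :=
        mul_le_mul_of_nonneg_left h4 (Int.natCast_nonneg k)
    _ ≤ _ := by exact_mod_cast h6

theorem abs_indicator_one_le (C : Set X) (x : X) : |C.indicator (1 : X → ℤ) x| ≤ 1 := by
  by_cases h : x ∈ C <;> simp [h]

variable [TopologicalSpace X] [ContinuousConstVAdd (Fin d → ℤ) X]

theorem coboundaries_le_meanNull :
    coboundaries X d ≤ (meanNull X d).comap ContinuousMap.coeFnAddMonoidHom := by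
  refine (AddSubgroup.closure_le _).2 ?_
  rintro f ⟨A, v, rfl⟩
  have h := neg_mem (comp_vadd_sub_mem_meanNull (abs_indicator_one_le (A : Set X)) (-v))
  have e : (ContinuousMap.coeFnAddMonoidHom (ind A - ind (translate v A)) : X → ℤ) =
      -((fun x => (A : Set X).indicator (1 : X → ℤ) (-v +ᵥ x)) - (A : Set X).indicator 1) := by
    rw [neg_sub]
    funext x
    have : x ∈ (translate v A : Set X) ↔ -v +ᵥ x ∈ (A : Set X) := by
      constructor
      · rintro ⟨z, hz, rfl⟩
        simpa using hz
      · intro hx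
        exact ⟨_, hx, vadd_neg_vadd v x⟩
    have h1 : (translate v A : Set X).indicator (1 : X → ℤ) x =
        (A : Set X).indicator 1 (-v +ᵥ x) := by
      by_cases hx : -v +ᵥ x ∈ (A : Set X)
      · rw [indicator_of_mem hx, indicator_of_mem (this.2 hx), Pi.one_apply, Pi.one_apply]
      · rw [indicator_of_notMem hx, indicator_of_notMem (mt this.1 hx)]
    simp only [ContinuousMap.coeFnAddMonoidHom_apply, ContinuousMap.coe_sub, Pi.sub_apply, ind,
      ContinuousMap.coe_mk, h1]
  show _ ∈ meanNull X d
  rw [e]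
  exact h

theorem sub_mem_meanNull_of_mem_Inf [Nonempty X] {A B : TopologicalSpace.Clopens X}
    (h : cls d A - cls d B ∈ Inf X d) :
    (A : Set X).indicator 1 - (B : Set X).indicator 1 ∈ meanNull X d := by
  have hpos : (QuotientAddGroup.mk (1 : C(X, ℤ)) : G X d) ∈ Gpos X d \ {0} := by
    refine ⟨⟨1, fun x => zero_le_one, rfl⟩, fun h0 => ?_⟩
    have h1 := coboundaries_le_meanNull ((QuotientAddGroup.eq_zero_iff _).1 h0)
    obtain ⟨N, hN⟩ := (mem_meanNull.1 h1 2).exists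
    have h2 := hN (Classical.arbitrary X)
    have h3 : boxSum d N (ContinuousMap.coeFnAddMonoidHom (1 : C(X, ℤ))) (Classical.arbitrary X)
        = (box d N).card := boxSum_one N _
    rw [h3, Nat.abs_cast] at h2
    have := card_box_pos (d := d) N
    push_cast at h2
    omega
  -- Modulo a coboundary, 1 - n(1_A - 1_B) is nonnegative, so n times the box sum is at most |box|
  -- plus an error of at most |box|. Both signs of 2k are used below.
  have key : ∀ n : ℤ, ∀ᶠ N : ℕ in atTop, ∀ y : X,
      n * boxSum d N ((A : Set X).indicator 1 - (B : Set X).indicator 1) y ≤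
        2 * (box d N).card := by
    intro n
    obtain ⟨⟨f, hf, hfe⟩, -⟩ := h n _ hpos
    have h1 : -f + (1 - n • (ind A - ind B)) ∈ coboundaries X d := QuotientAddGroup.eq.1 hfe
    have h2 := coboundaries_le_meanNull h1
    filter_upwards [mem_meanNull.1 h2 1] with N hN y
    have h3 := hN y
    have e : (ContinuousMap.coeFnAddMonoidHom (-f + (1 - n • (ind A - ind B))) : X → ℤ) =
        -⇑f + (1 - n • ((A : Set X).indicator 1 - (B : Set X).indicator 1)) := rfl
    rw [e, boxSum_add, boxSum_neg, boxSum_sub, boxSum_one, boxSum_zsmul] at h3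
    have h4 := boxSum_nonneg (d := d) N hf y
    have h5 := neg_abs_le (-boxSum d N (⇑f) y + ((box d N).card -
      n * boxSum d N ((A : Set X).indicator 1 - (B : Set X).indicator 1) y))
    push_cast at h3
    linarith
  intro k
  filter_upwards [key (2 * k), key (-(2 * k))] with N h1 h2 y
  have h3 := h1 y
  have h4 := h2 y
  rcases abs_cases (boxSum d N ((A : Set X).indicator 1 - (B : Set X).indicator 1) y) with h | h <;>
  · rw [h.1]
    linarith

/-- By minimality and compactness finitely many translates of C cover X, and all have asymptotically
the same frequency. -/
theorem exists_card_box_le_boxSum [CompactSpace X] [AddAction.IsMinimal (Fin d → ℤ) X]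
    {C : Set X} (hC : IsOpen C) (hne : C.Nonempty) :
    ∃ k : ℕ, 0 < k ∧ ∀ᶠ N : ℕ in atTop, ∀ y : X,
      ((box d N).card : ℤ) ≤ k * boxSum d N (C.indicator 1) y := by
  obtain ⟨I, hI⟩ := isCompact_univ.exists_finite_cover_vadd (Fin d → ℤ) hC hne
  set f : X → ℤ := ∑ g ∈ I, fun x => C.indicator (1 : X → ℤ) (-g +ᵥ x) with hf
  have hf1 : ∀ x, (1 : X → ℤ) x ≤ f x := by
    intro x
    obtain ⟨g, hg, c, hc, e⟩ := mem_iUnion₂.1 (hI (mem_univ x))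
    have h1 : C.indicator (1 : X → ℤ) (-g +ᵥ x) = 1 := by
      have : -g +ᵥ x ∈ C := by rw [← e]; simpa using hc
      simp [this]
    rw [hf, Finset.sum_apply]
    refine h1.ge.trans (Finset.single_le_sum
      (f := fun g : Fin d → ℤ => C.indicator (1 : X → ℤ) (-g +ᵥ x)) (fun g' _ => ?_) hg)
    exact indicator_nonneg (fun _ _ => zero_le_one) (-g' +ᵥ x)
  have hnull : f - (I.card : ℤ) • C.indicator (1 : X → ℤ) ∈ meanNull X d := by
    have : f - (I.card : ℤ) • C.indicator (1 : X → ℤ) =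
        ∑ g ∈ I, ((fun x => C.indicator (1 : X → ℤ) (-g +ᵥ x)) - C.indicator 1) := by
      rw [Finset.sum_sub_distrib, Finset.sum_const, natCast_zsmul]
    rw [this]
    exact sum_mem fun g _ => comp_vadd_sub_mem_meanNull (abs_indicator_one_le C) _
  -- The factor 2 absorbs the error from `hnull`; the summand 1 only serves positivity.
  refine ⟨2 * I.card + 1, by omega, ?_⟩
  filter_upwards [mem_meanNull.1 hnull 2] with N hN y
  have h1 := hN y
  rw [boxSum_sub, boxSum_zsmul] at h1
  have h2 := boxSum_mono (d := d) N hf1 y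
  rw [boxSum_one] at h2
  have h3 := le_abs_self (boxSum d N f y - I.card * boxSum d N (C.indicator 1) y)
  have h4 : 0 ≤ boxSum d N (C.indicator 1) y :=
    boxSum_nonneg N (fun x => indicator_nonneg (fun _ _ => zero_le_one) x) y
  push_cast at h1 ⊢
  linarith

/-- An infinite orbit supplies 2k translations whose inverses carry a small V to disjoint sets of
asymptotically equal frequency. -/
theorem exists_isClopen_boxSum_le [CompactSpace X] [T2Space X] [TotallyDisconnectedSpace X]
    (hstab : ∀ (g : Fin d → ℤ) (x y : X), g +ᵥ x = x → g +ᵥ y = y)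
    {x : X} (hinf : (AddAction.orbit (Fin d → ℤ) x).Infinite) {U : Set X} (hU : U ∈ 𝓝 x) (k : ℕ) :
    ∃ V, IsClopen V ∧ x ∈ V ∧ V ⊆ U ∧ ∀ᶠ N : ℕ in atTop, ∀ y : X,
      (k : ℤ) * boxSum d N (V.indicator 1) y ≤ (box d N).card := by
  classical
  obtain ⟨t, htsub, htcard⟩ := hinf.exists_subset_card_eq (2 * k)
  choose! c hc using fun z (hz : z ∈ t) =>
    (show ∃ g : Fin d → ℤ, g +ᵥ x = z from htsub hz)
  obtain ⟨L, hL⟩ := exists_subset_box (t.image c)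
  obtain ⟨V₁, hV₁, hsep⟩ := exists_nhds_separated hstab x (L + L)
  obtain ⟨V, hV, hxV, hVsub⟩ := exists_isClopen_mem_subset (inter_mem hV₁ hU)
  refine ⟨V, hV, hxV, fun z hz => (hVsub hz).2, ?_⟩
  set f : X → ℤ := ∑ z ∈ t, fun y => V.indicator (1 : X → ℤ) (c z +ᵥ y) with hf
  have hf1 : ∀ y, f y ≤ (1 : X → ℤ) y := by
    intro y
    rw [hf, Finset.sum_apply]
    simp only [indicator_apply, Pi.one_apply, Finset.sum_boole]
    have : (t.filter fun z => c z +ᵥ y ∈ V).card ≤ 1 := by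
      rw [Finset.card_le_one]
      intro z hz z' hz'
      obtain ⟨hz1, hz2⟩ := Finset.mem_filter.1 hz
      obtain ⟨hz1', hz2'⟩ := Finset.mem_filter.1 hz'
      have e := hsep _ (hVsub hz2).1 _ (hVsub hz2').1 (c z' + -c z)
        (add_mem_box (hL (Finset.mem_image_of_mem c hz1'))
          (neg_mem_box (hL (Finset.mem_image_of_mem c hz1))))
        (by rw [add_vadd, neg_vadd_vadd])
      rw [← hc z hz1, ← hc z' hz1', vadd_eq_vadd_of_stabilizers_eq hstab x e]
    exact_mod_cast this
  have hnull : f - ((2 * k : ℕ) : ℤ) • V.indicator (1 : X → ℤ) ∈ meanNull X d := by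
    have : f - ((2 * k : ℕ) : ℤ) • V.indicator (1 : X → ℤ) =
        ∑ z ∈ t, ((fun y => V.indicator (1 : X → ℤ) (c z +ᵥ y)) - V.indicator 1) := by
      rw [Finset.sum_sub_distrib, Finset.sum_const, natCast_zsmul, htcard]
    rw [this]
    exact sum_mem fun g _ => comp_vadd_sub_mem_meanNull (abs_indicator_one_le V) _
  filter_upwards [mem_meanNull.1 hnull 1] with N hN y
  have h1 := hN y
  rw [boxSum_sub, boxSum_zsmul] at h1
  have h2 := boxSum_mono (d := d) N hf1 y
  rw [boxSum_one] at h2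
  have h3 := neg_abs_le (boxSum d N f y - (2 * k : ℕ) * boxSum d N (V.indicator 1) y)
  push_cast at h1 h3
  linarith

end Mean

/-! ### Equidecomposable clopen sets and the back-and-forth step. -/

section Equidecomposition

variable {X : Type*} {d : ℕ} [TopologicalSpace X] [AddAction (Fin d → ℤ) X]

/-- `C` and `E` are equidecomposable: a map that acts locally as a single element of `ℤ^d` sends
`C` bijectively to `E`. -/
def Equidec (d : ℕ) [AddAction (Fin d → ℤ) X] (C E : Set X) : Prop :=
  ∃ c : X → (Fin d → ℤ), IsLocallyConstant c ∧ BijOn (fun x => c x +ᵥ x) C E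

theorem Equidec.union {C C' E E' : Set X} (h : Equidec d C E) (h' : Equidec d C' E')
    (hC : IsClopen C) (hCC : Disjoint C C') (hEE : Disjoint E E') :
    Equidec d (C ∪ C') (E ∪ E') := by
  classical
  obtain ⟨c, hc, hb⟩ := h
  obtain ⟨c', hc', hb'⟩ := h'
  have e1 : ∀ x ∈ C, C.piecewise c c' x = c x := fun x hx => piecewise_eq_of_mem _ _ _ hx
  have e2 : ∀ x, x ∉ C → C.piecewise c c' x = c' x := fun x hx => piecewise_eq_of_notMem _ _ _ hx
  have hb1 : BijOn (fun x => C.piecewise c c' x +ᵥ x) C E :=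
    hb.congr fun x hx => by simp only [e1 x hx]
  have hb2 : BijOn (fun x => C.piecewise c c' x +ᵥ x) C' E' :=
    hb'.congr fun x hx => by simp only [e2 x (disjoint_right.1 hCC hx)]
  refine ⟨C.piecewise c c', ?_, hb1.union hb2 ?_⟩
  · rw [IsLocallyConstant.iff_eventually_eq]
    intro x
    by_cases hx : x ∈ C
    · filter_upwards [hC.isOpen.mem_nhds hx, hc.eventually_eq x] with y hy hy'
      rw [e1 x hx, e1 y hy, hy']
    · filter_upwards [hC.compl.isOpen.mem_nhds hx, hc'.eventually_eq x] with y hy hy'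
      rw [e2 x hx, e2 y hy, hy']
  · rintro x (hx | hx) y (hy | hy) e
    all_goals simp only at e
    · exact hb1.injOn hx hy e
    · exact (disjoint_left.1 hEE (e ▸ hb1.mapsTo hx) (hb2.mapsTo hy)).elim
    · exact (disjoint_left.1 hEE (e ▸ hb1.mapsTo hy) (hb2.mapsTo hx)).elim
    · exact hb2.injOn hx hy e

variable [ContinuousConstVAdd (Fin d → ℤ) X]

theorem continuousAt_vadd_of_eventuallyEq {c : X → (Fin d → ℤ)} {x : X}
    (hc : ∀ᶠ y in 𝓝 x, c y = c x) : ContinuousAt (fun y => c y +ᵥ y) x := by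
  refine (continuous_const_vadd (c x)).continuousAt.congr ?_
  filter_upwards [hc] with y hy
  rw [hy]

theorem isOpen_image_vadd {c : X → (Fin d → ℤ)} (hc : IsLocallyConstant c) {C : Set X}
    (hC : IsOpen C) : IsOpen ((fun x => c x +ᵥ x) '' C) := by
  rw [isOpen_iff_mem_nhds]
  rintro _ ⟨x, hx, rfl⟩
  have ht : Tendsto (fun z : X => -c x +ᵥ z) (𝓝 (c x +ᵥ x)) (𝓝 x) := by
    have := (continuous_const_vadd (-c x)).tendsto (c x +ᵥ x)
    rwa [neg_vadd_vadd] at this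
  filter_upwards [ht (hC.mem_nhds hx), ht (hc.eventually_eq x)] with z hz hz'
  refine ⟨_, hz, ?_⟩
  simp only [mem_preimage, mem_ofPred_eq] at hz'
  simp only [hz', vadd_neg_vadd]

variable [CompactSpace X] [T2Space X]

theorem isClopen_image_vadd {c : X → (Fin d → ℤ)} (hc : IsLocallyConstant c) {C : Set X}
    (hC : IsClopen C) : IsClopen ((fun x => c x +ᵥ x) '' C) := by
  refine ⟨(hC.isClosed.isCompact.image ?_).isClosed, isOpen_image_vadd hc hC.isOpen⟩
  exact continuous_iff_continuousAt.2 fun x =>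
    continuousAt_vadd_of_eventuallyEq (hc.eventually_eq x)

theorem Equidec.symm {C E : Set X} (h : Equidec d C E) (hC : IsClopen C) : Equidec d E C := by
  classical
  obtain ⟨c, hc, hb⟩ := h
  have hE : IsClopen E := hb.image_eq ▸ isClopen_image_vadd hc hC
  choose! f hfC hf using fun z (hz : z ∈ E) => hb.surjOn hz
  have hfe : ∀ x ∈ C, f (c x +ᵥ x) = x := fun x hx =>
    hb.injOn (hfC _ (hb.mapsTo hx)) hx (hf _ (hb.mapsTo hx))
  set c' : X → (Fin d → ℤ) := E.piecewise (fun z => -c (f z)) 0 with hc'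
  have e1 : ∀ x ∈ C, c' (c x +ᵥ x) = -c x := by
    intro x hx
    rw [hc', piecewise_eq_of_mem _ _ _ (hb.mapsTo hx), hfe x hx]
  have e2 : ∀ z, z ∉ E → c' z = 0 := fun z hz => piecewise_eq_of_notMem _ _ _ hz
  refine ⟨c', ?_, ?_⟩
  · rw [IsLocallyConstant.iff_eventually_eq]
    intro z
    by_cases hz : z ∈ E
    · obtain ⟨x, hx, rfl⟩ := hb.surjOn hz
      have ht : Tendsto (fun z : X => -c x +ᵥ z) (𝓝 (c x +ᵥ x)) (𝓝 x) := by
        have := (continuous_const_vadd (-c x)).tendsto (c x +ᵥ x)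
        rwa [neg_vadd_vadd] at this
      filter_upwards [ht (hC.isOpen.mem_nhds hx), ht (hc.eventually_eq x)] with y hy hy'
      simp only [mem_preimage, mem_ofPred_eq] at hy hy'
      have e3 := e1 _ hy
      rw [hy', vadd_neg_vadd] at e3
      rw [e3]
      exact (e1 x hx).symm
    · filter_upwards [hE.compl.isOpen.mem_nhds hz] with y hy
      rw [e2 z hz, e2 y hy]
  · refine ⟨?_, ?_, ?_⟩
    · intro z hz
      obtain ⟨x, hx, rfl⟩ := hb.surjOn hz
      simpa only [e1 x hx, neg_vadd_vadd] using hx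
    · intro z hz z' hz' e
      obtain ⟨x, hx, rfl⟩ := hb.surjOn hz
      obtain ⟨x', hx', rfl⟩ := hb.surjOn hz'
      simp only [e1 x hx, e1 x' hx', neg_vadd_vadd] at e
      rw [e]
    · intro x hx
      exact ⟨_, hb.mapsTo hx, by simp only [e1 x hx, neg_vadd_vadd]⟩

omit [ContinuousConstVAdd (Fin d → ℤ) X] [T2Space X] in
theorem Equidec.indicator_sub_mem_meanNull {C E : Set X} (h : Equidec d C E) :
    C.indicator 1 - E.indicator 1 ∈ meanNull X d := by
  classical
  obtain ⟨c, hc, hb⟩ := h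
  set I := hc.range_finite.toFinset with hI
  have hcI : ∀ x, c x ∈ I := fun x => hc.range_finite.mem_toFinset.2 (mem_range_self x)
  set D : (Fin d → ℤ) → Set X := fun g => C ∩ {x | c x = g} with hD
  have h1 : C.indicator (1 : X → ℤ) = ∑ g ∈ I, (D g).indicator 1 := by
    funext x
    rw [Finset.sum_apply]
    by_cases hx : x ∈ C
    · rw [Finset.sum_eq_single (c x), indicator_of_mem hx,
        indicator_of_mem (show x ∈ D (c x) from ⟨hx, rfl⟩),
        Pi.one_apply]
      · intro g _ hg
        exact indicator_of_notMem (fun h => hg h.2.symm) _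
      · exact fun h => (h (hcI x)).elim
    · rw [indicator_of_notMem hx, Finset.sum_eq_zero]
      exact fun g _ => indicator_of_notMem (fun h => hx h.1) _
  have h2 : E.indicator (1 : X → ℤ) = ∑ g ∈ I, fun z => (D g).indicator 1 (-g +ᵥ z) := by
    funext z
    rw [Finset.sum_apply]
    by_cases hz : z ∈ E
    · obtain ⟨x, hx, rfl⟩ := hb.surjOn hz
      rw [Finset.sum_eq_single (c x), indicator_of_mem hz, indicator_of_mem]
      · rfl
      · rw [neg_vadd_vadd]
        exact ⟨hx, rfl⟩
      · intro g _ hg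
        refine indicator_of_notMem (fun h => hg ?_) _
        have h3 : -g +ᵥ (c x +ᵥ x) = x := by
          refine hb.injOn h.1 hx ?_
          have h4 : c (-g +ᵥ (c x +ᵥ x)) = g := h.2
          simp only [h4, vadd_neg_vadd]
        have h5 := h.2
        simp only [h3, mem_ofPred_eq] at h5
        exact h5.symm
      · exact fun h => (h (hcI x)).elim
    · rw [indicator_of_notMem hz, Finset.sum_eq_zero]
      intro g _
      refine indicator_of_notMem (fun h => hz ?_) _
      have h3 := hb.mapsTo h.1
      have h4 : c (-g +ᵥ z) = g := h.2
      simpa only [h4, vadd_neg_vadd] using h3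
  rw [h1, h2, ← Finset.sum_sub_distrib]
  refine sum_mem fun g _ => ?_
  rw [← neg_sub]
  exact neg_mem (comp_vadd_sub_mem_meanNull (abs_indicator_one_le _) _)

variable [TotallyDisconnectedSpace X] [AddAction.IsMinimal (Fin d → ℤ) X]

/-- A \ A' embeds in B \ V for a rare neighbourhood V of y; the part of B missed by the image is B',
and it contains V. -/
theorem exists_equidec_diff
    (hstab : ∀ (g : Fin d → ℤ) (x y : X), g +ᵥ x = x → g +ᵥ y = y)
    (hinf : ∀ x : X, (AddAction.orbit (Fin d → ℤ) x).Infinite)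
    {A A' B : Set X} (hA : IsClopen A) (hA' : IsClopen A') (hB : IsClopen B)
    (hnull : A.indicator 1 - B.indicator 1 ∈ meanNull X d) (hsub : A' ⊆ A) (hne : A'.Nonempty)
    {y : X} (hy : y ∈ B) :
    ∃ B', IsClopen B' ∧ B' ⊆ B ∧ y ∈ B' ∧ Equidec d (A \ A') (B \ B') ∧
      A'.indicator 1 - B'.indicator 1 ∈ meanNull X d := by
  obtain ⟨k, hk, hpos⟩ := exists_card_box_le_boxSum (d := d) hA'.isOpen hne
  -- The set A' has frequency at least 1/k, while V and the discrepancy of A and B cost at most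
  -- 1/(4k) each, leaving a positive excess.
  obtain ⟨V, hV, hyV, hVB, hsmall⟩ :=
    exists_isClopen_boxSum_le hstab (hinf y) (hB.isOpen.mem_nhds hy) (4 * k)
  obtain ⟨N, hN1, hN2, hN3⟩ :=
    (hpos.and (hsmall.and (mem_meanNull.1 hnull (4 * k)))).exists
  obtain ⟨c, hc, hmaps, hinj⟩ := exists_injOn_of_box_count_lt hstab (hA.diff hA') (hB.diff hV)
    (N := N) (by
      classical
      intro z
      have h1 := hN1 z
      have h2 := hN2 z
      have h3 := hN3 z
      have e1 := boxSum_indicator (d := d) N (A \ A') z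
      have e2 := boxSum_indicator (d := d) N (B \ V) z
      rw [indicator_sdiff hsub, boxSum_sub] at e1
      rw [indicator_sdiff hVB, boxSum_sub] at e2
      rw [boxSum_sub] at h3
      have h4 := le_abs_self (boxSum d N (A.indicator 1) z - boxSum d N (B.indicator 1) z)
      have h5 : (4 * k : ℤ) * (boxSum d N (A.indicator 1) z - boxSum d N (B.indicator 1) z) ≤
          (box d N).card := le_trans (mul_le_mul_of_nonneg_left h4 (by positivity))
            (by exact_mod_cast h3)
      have h6 : (0 : ℤ) < (box d N).card := by exact_mod_cast card_box_pos N
      have h7 : (0 : ℤ) < 4 * k * ((boxSum d N (B.indicator 1) z - boxSum d N (V.indicator 1) z) -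
          (boxSum d N (A.indicator 1) z - boxSum d N (A'.indicator 1) z)) := by
        push_cast at h2
        linarith
      have h8 := pos_of_mul_pos_right h7 (by positivity)
      rw [e1, e2] at h8
      convert Nat.succ_le_of_lt (Int.ofNat_lt.1 (sub_pos.1 h8)))
  set E := (fun x => c x +ᵥ x) '' (A \ A') with hE
  have hEcl : IsClopen E := isClopen_image_vadd hc (hA.diff hA')
  have hEBV : E ⊆ B \ V := hmaps.image_subset
  have hEB : E ⊆ B := fun z hz => (hEBV hz).1
  have heq : Equidec d (A \ A') E := ⟨c, hc, hinj.bijOn_image⟩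
  refine ⟨B \ E, hB.diff hEcl, sdiff_subset, ⟨hy, fun h => (hEBV h).2 hyV⟩, ?_, ?_⟩
  · rwa [sdiff_sdiff_cancel_left hEB]
  · have h1 := sub_mem hnull heq.indicator_sub_mem_meanNull
    rw [indicator_sdiff hsub] at h1
    rw [indicator_sdiff hEB]
    convert h1 using 1
    abel

/-- The leftover in B is not controlled in size, so a second application with the roles exchanged
shrinks it into V; the leftover in A then stays inside U. -/
theorem exists_equidec_diff_nhds
    (hstab : ∀ (g : Fin d → ℤ) (x y : X), g +ᵥ x = x → g +ᵥ y = y)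
    (hinf : ∀ x : X, (AddAction.orbit (Fin d → ℤ) x).Infinite)
    {A B : Set X} (hA : IsClopen A) (hB : IsClopen B)
    (hnull : A.indicator 1 - B.indicator 1 ∈ meanNull X d)
    {x y : X} (hx : x ∈ A) (hy : y ∈ B) {U V : Set X} (hU : U ∈ 𝓝 x) (hV : V ∈ 𝓝 y) :
    ∃ A' B', IsClopen A' ∧ IsClopen B' ∧ x ∈ A' ∧ y ∈ B' ∧ A' ⊆ A ∩ U ∧ B' ⊆ B ∩ V ∧
      Equidec d (A \ A') (B \ B') ∧ A'.indicator 1 - B'.indicator 1 ∈ meanNull X d := by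
  obtain ⟨A₁, hA₁, hxA₁, hAsub⟩ :=
    exists_isClopen_mem_subset (inter_mem (hA.isOpen.mem_nhds hx) hU)
  obtain ⟨B₁, hB₁, hB₁B, hyB₁, heq₁, hnull₁⟩ := exists_equidec_diff hstab hinf hA hA₁ hB hnull
    (fun z hz => (hAsub hz).1) ⟨x, hxA₁⟩ hy
  obtain ⟨B₂, hB₂, hyB₂, hBsub⟩ :=
    exists_isClopen_mem_subset (inter_mem (hB₁.isOpen.mem_nhds hyB₁) hV)
  have hB₂B₁ : B₂ ⊆ B₁ := fun z hz => (hBsub hz).1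
  obtain ⟨A₂, hA₂, hA₂A₁, hxA₂, heq₂, hnull₂⟩ := exists_equidec_diff hstab hinf hB₁ hB₂ hA₁
    (by rw [← neg_sub]; exact neg_mem hnull₁) hB₂B₁ ⟨y, hyB₂⟩ hxA₁
  refine ⟨A₂, B₂, hA₂, hB₂, hxA₂, hyB₂, hA₂A₁.trans hAsub,
    fun z hz => ⟨hB₁B (hB₂B₁ hz), (hBsub hz).2⟩, ?_, by rw [← neg_sub]; exact neg_mem hnull₂⟩
  have h := heq₁.union (heq₂.symm (hB₁.diff hB₂)) (hA.diff hA₁)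
    (disjoint_left.2 fun z hz hz' => hz.2 hz'.1) (disjoint_left.2 fun z hz hz' => hz.2 hz'.1)
  rwa [sdiff_union_sdiff_cancel (fun z hz => (hAsub hz).1) hA₂A₁,
    sdiff_union_sdiff_cancel hB₁B hB₂B₁] at h

end Equidecomposition

/-! ### Gluing the pieces around the two marked points. -/

section Gluing

theorem exists_mem_diff_succ {X : Type*} {S : ℕ → Set X} {a x : X} (hS : ⋂ n, S n ⊆ {a})
    (hx : x ∈ S 0) (hxa : x ≠ a) : ∃ n, x ∈ S n \ S (n + 1) := by
  by_contra hcon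
  push Not at hcon
  have : ∀ n, x ∈ S n := by
    intro n
    induction n with
    | zero => exact hx
    | succ n ih => exact by_contra fun h => hcon n ⟨ih, h⟩
  exact hxa (hS (mem_iInter.2 this))

theorem eq_of_mem_diff_succ {X : Type*} {S : ℕ → Set X} (hS : Antitone S) {x : X} {m n : ℕ}
    (hm : x ∈ S m \ S (m + 1)) (hn : x ∈ S n \ S (n + 1)) : m = n := by
  rcases lt_trichotomy m n with h | h | h
  · exact (hm.2 (hS h hn.1)).elim
  · exact h
  · exact (hn.2 (hS h hm.1)).elim

variable {X : Type*} {d : ℕ} [TopologicalSpace X] [AddAction (Fin d → ℤ) X]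
  [ContinuousConstVAdd (Fin d → ℤ) X]

/-- On each S n \ S (n + 1) the cocycle is locally constant. At a the glued map is continuous
because it sends S n into T n and the T n shrink to b, although the cocycle itself may jump there.
-/
theorem exists_bijOn_of_sequence [T2Space X] {a b : X} {S T : ℕ → Set X}
    (hS : Antitone S) (hT : Antitone T) (hScl : ∀ n, IsClopen (S n))
    (ha : ∀ n, a ∈ S n) (hb : ∀ n, b ∈ T n)
    (hSa : ⋂ n, S n ⊆ {a}) (hTb : ∀ V ∈ 𝓝 b, ∃ n, T n ⊆ V) {w : Fin d → ℤ} (hw : b = w +ᵥ a)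
    (heq : ∀ n, Equidec d (S n \ S (n + 1)) (T n \ T (n + 1))) :
    ∃ ζ : X → (Fin d → ℤ), ζ a = w ∧ BijOn (fun x => ζ x +ᵥ x) (S 0) (T 0) ∧
      (∀ x ∈ S 0, ContinuousAt (fun x => ζ x +ᵥ x) x) ∧ ContinuousOn ζ (S 0 \ {a}) := by
  classical
  choose c hc hbij using heq
  have hTb' : ⋂ n, T n ⊆ {b} := by
    intro y hy
    by_contra hne
    obtain ⟨n, hn⟩ := hTb {y}ᶜ (isOpen_compl_singleton.mem_nhds fun h => hne h.symm)
    exact hn (mem_iInter.1 hy n) rfl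
  set ζ : X → (Fin d → ℤ) := fun x =>
    if h : ∃ n, x ∈ S n \ S (n + 1) then c h.choose x else w with hζ
  have hζn : ∀ n, ∀ x ∈ S n \ S (n + 1), ζ x = c n x := by
    intro n x hx
    have h : ∃ n, x ∈ S n \ S (n + 1) := ⟨n, hx⟩
    simp only [hζ, h, dif_pos]
    rw [eq_of_mem_diff_succ hS h.choose_spec hx]
  have hζa : ζ a = w := by
    have h : ¬ ∃ n, a ∈ S n \ S (n + 1) := fun ⟨n, hn⟩ => hn.2 (ha _)
    simp only [hζ, h, dif_neg, not_false_eq_true]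
  have hmap : ∀ n, ∀ x ∈ S n \ S (n + 1), ζ x +ᵥ x ∈ T n \ T (n + 1) := by
    intro n x hx
    rw [hζn n x hx]
    exact (hbij n).mapsTo hx
  have hmapa : ζ a +ᵥ a = b := by rw [hζa, hw]
  have hcase : ∀ n, ∀ x ∈ S n, x = a ∨ ∃ m, n ≤ m ∧ x ∈ S m \ S (m + 1) := by
    intro n x hx
    by_cases h : x = a
    · exact Or.inl h
    · obtain ⟨m, hm⟩ := exists_mem_diff_succ hSa (hS (Nat.zero_le n) hx) h
      exact Or.inr ⟨m, not_lt.1 fun hlt => hm.2 (hS hlt hx), hm⟩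
  have hmapS : ∀ n, ∀ x ∈ S n, ζ x +ᵥ x ∈ T n := by
    intro n x hx
    rcases hcase n x hx with rfl | ⟨m, hnm, hm⟩
    · rw [hmapa]
      exact hb n
    · exact hT hnm (hmap m x hm).1
  have hev : ∀ n, ∀ x ∈ S n \ S (n + 1), ∀ᶠ y in 𝓝 x, ζ y = ζ x := by
    intro n x hx
    filter_upwards [((hScl n).diff (hScl (n + 1))).isOpen.mem_nhds hx,
      (hc n).eventually_eq x] with y hy hy'
    rw [hζn n y hy, hζn n x hx, hy']
  refine ⟨ζ, hζa, ⟨hmapS 0, ?_, ?_⟩, ?_, ?_⟩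
  · intro x hx y hy e
    simp only at e
    rcases hcase 0 x hx with rfl | ⟨m, -, hm⟩ <;> rcases hcase 0 y hy with rfl | ⟨n, -, hn⟩
    · rfl
    · have := hmap n y hn
      rw [← e, hmapa] at this
      exact (this.2 (hb _)).elim
    · have := hmap m x hm
      rw [e, hmapa] at this
      exact (this.2 (hb _)).elim
    · have h1 := hmap m x hm
      rw [e] at h1
      obtain rfl := eq_of_mem_diff_succ hT h1 (hmap n y hn)
      rw [hζn m x hm, hζn m y hn] at e
      exact (hbij m).injOn hm hn e
  · intro y hy
    by_cases hyb : y = b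
    · exact ⟨a, ha 0, hmapa.trans hyb.symm⟩
    · obtain ⟨n, hn⟩ := exists_mem_diff_succ hTb' hy hyb
      obtain ⟨x, hx, rfl⟩ := (hbij n).surjOn hn
      exact ⟨x, hS (Nat.zero_le n) hx.1, by simp only [hζn n x hx]⟩
  · intro x hx
    rcases hcase 0 x hx with rfl | ⟨m, -, hm⟩
    · intro V hV
      simp only [hmapa] at hV
      obtain ⟨n, hn⟩ := hTb V hV
      rw [mem_map]
      filter_upwards [(hScl n).isOpen.mem_nhds (ha n)] with y hy using hn (hmapS n y hy)
    · exact continuousAt_vadd_of_eventuallyEq (hev m x hm)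
  · rintro x ⟨hx, hxa⟩
    obtain ⟨m, hm⟩ := exists_mem_diff_succ hSa hx hxa
    exact (ContinuousAt.congr continuousAt_const
      ((hev m x hm).mono fun y hy => hy.symm)).continuousWithinAt

variable [CompactSpace X] [T2Space X] [TotallyDisconnectedSpace X] [FirstCountableTopology X]
  [AddAction.IsMinimal (Fin d → ℤ) X]

theorem exists_bijOn_of_meanNull
    (hstab : ∀ (g : Fin d → ℤ) (x y : X), g +ᵥ x = x → g +ᵥ y = y)
    (hinf : ∀ x : X, (AddAction.orbit (Fin d → ℤ) x).Infinite)
    {A B : Set X} (hA : IsClopen A) (hB : IsClopen B)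
    (hnull : A.indicator 1 - B.indicator 1 ∈ meanNull X d)
    {a b : X} (ha : a ∈ A) (hb : b ∈ B) {w : Fin d → ℤ} (hw : b = w +ᵥ a) :
    ∃ ζ : X → (Fin d → ℤ), ζ a = w ∧ BijOn (fun x => ζ x +ᵥ x) A B ∧
      (∀ x ∈ A, ContinuousAt (fun x => ζ x +ᵥ x) x) ∧ ContinuousOn ζ (A \ {a}) := by
  obtain ⟨U, hU⟩ := (𝓝 a).exists_antitone_basis
  obtain ⟨V, hV⟩ := (𝓝 b).exists_antitone_basis
  set Good : Set X × Set X → Prop := fun p => IsClopen p.1 ∧ IsClopen p.2 ∧ a ∈ p.1 ∧ b ∈ p.2 ∧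
    p.1.indicator 1 - p.2.indicator 1 ∈ meanNull X d with hGood
  have hstep : ∀ (n : ℕ) (p : Set X × Set X), Good p → ∃ p', Good p' ∧ p'.1 ⊆ p.1 ∩ U n ∧
      p'.2 ⊆ p.2 ∩ V n ∧ Equidec d (p.1 \ p'.1) (p.2 \ p'.2) := by
    rintro n ⟨A, B⟩ ⟨hA, hB, ha, hb, hnull⟩
    obtain ⟨A', B', h1, h2, h3, h4, h5, h6, h7, h8⟩ := exists_equidec_diff_nhds hstab hinf hA hB
      hnull ha hb (hU.1.mem_of_mem (i := n) trivial) (hV.1.mem_of_mem (i := n) trivial)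
    exact ⟨(A', B'), ⟨h1, h2, h3, h4, h8⟩, h5, h6, h7⟩
  choose! f hf1 hf2 hf3 hf4 using hstep
  set P : ℕ → Set X × Set X := fun n => Nat.rec (A, B) f n with hP
  have hgood : ∀ n, Good (P n) := by
    intro n
    induction n with
    | zero => exact ⟨hA, hB, ha, hb, hnull⟩
    | succ n ih => exact hf1 n _ ih
  have hP1 : ∀ n, (P (n + 1)).1 ⊆ (P n).1 ∩ U n := fun n => hf2 n _ (hgood n)
  have hP2 : ∀ n, (P (n + 1)).2 ⊆ (P n).2 ∩ V n := fun n => hf3 n _ (hgood n)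
  refine exists_bijOn_of_sequence (S := fun n => (P n).1) (T := fun n => (P n).2)
    (antitone_nat_of_succ_le fun n x hx => (hP1 n hx).1)
    (antitone_nat_of_succ_le fun n x hx => (hP2 n hx).1) (fun n => (hgood n).1)
    (fun n => (hgood n).2.2.1) (fun n => (hgood n).2.2.2.1) ?_ ?_ hw
    (fun n => hf4 n _ (hgood n))
  · intro x hx
    by_contra hne
    obtain ⟨n, -, hn⟩ := hU.1.mem_iff.1 (isOpen_compl_singleton.mem_nhds
      (fun h => hne h.symm : a ∈ ({x}ᶜ : Set X)))
    exact hn (hP1 n (mem_iInter.1 hx (n + 1))).2 rfl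
  · intro W hW
    obtain ⟨n, -, hn⟩ := hV.1.mem_iff.1 hW
    exact ⟨n + 1, fun x hx => hn (hP2 n hx).2⟩

end Gluing

end CantorSystem

/-! ### Consequences of minimality and the main theorem. -/

/-- The fixed set of g is closed and, by commutativity, contains the dense orbit of x. -/
theorem CantorSystem.stabilizer_eq {d : ℕ} {X : Type*} [TopologicalSpace X] [T2Space X]
    [AddAction (Fin d → ℤ) X] [ContinuousConstVAdd (Fin d → ℤ) X]
    [AddAction.IsMinimal (Fin d → ℤ) X] (g : Fin d → ℤ) (x y : X) (h : g +ᵥ x = x) :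
    g +ᵥ y = y := by
  have hcl : IsClosed {z : X | g +ᵥ z = z} := isClosed_eq (continuous_const_vadd g) continuous_id
  have hsub : AddAction.orbit (Fin d → ℤ) x ⊆ {z : X | g +ᵥ z = z} := by
    rintro _ ⟨v, rfl⟩
    show g +ᵥ v +ᵥ x = v +ᵥ x
    rw [← add_vadd, add_comm, add_vadd, h]
  have := (AddAction.dense_orbit (Fin d → ℤ) x).closure_eq ▸ hcl.closure_subset_iff.2 hsub
  exact this (Set.mem_univ y)

theorem CantorSystem.infinite_orbit {d : ℕ} {X : Type*} [TopologicalSpace X] [T2Space X]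
    [Infinite X] [AddAction (Fin d → ℤ) X]
    [AddAction.IsMinimal (Fin d → ℤ) X] (x : X) : (AddAction.orbit (Fin d → ℤ) x).Infinite := by
  intro hfin
  have h := (AddAction.dense_orbit (Fin d → ℤ) x).closure_eq
  rw [hfin.isClosed.closure_eq] at h
  exact Set.infinite_univ (h ▸ hfin)

theorem mainTheorem7 {d : ℕ} {X : Type*} [TopologicalSpace X] (hX : CantorSystem.IsCantorSet X)
    [AddAction (Fin d → ℤ) X] [ContinuousConstVAdd (Fin d → ℤ) X]
    [AddAction.IsMinimal (Fin d → ℤ) X]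
    (A B : TopologicalSpace.Clopens X)
    (hAB : CantorSystem.cls d A - CantorSystem.cls d B ∈ CantorSystem.Inf X d)
    (x₀ y₀ : X) (w : Fin d → ℤ) (hx₀ : x₀ ∈ A) (hy₀ : y₀ ∈ B) (hw : y₀ = w +ᵥ x₀) :
    ∃ π ∈ CantorSystem.fullGroup X d,
      (fun x => π x) '' (A : Set X) = (B : Set X) ∧ π x₀ = y₀ ∧
      ∃ ζ : X → (Fin d → ℤ),
        (∀ x, π x = ζ x +ᵥ x) ∧ ContinuousOn ζ ((A : Set X) \ {x₀}) := by
  classical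
  obtain ⟨e⟩ := hX
  have : CompactSpace X := e.symm.compactSpace
  have : T2Space X := e.symm.t2Space
  have : TotallyDisconnectedSpace X := e.symm.totallyDisconnectedSpace
  have : FirstCountableTopology X := e.isInducing.firstCountableTopology
  have : Infinite X := e.toEquiv.infinite_iff.2 inferInstance
  have : Nonempty X := ⟨x₀⟩
  have hstab := CantorSystem.stabilizer_eq (d := d) (X := X)
  have hinf := CantorSystem.infinite_orbit (d := d) (X := X)
  have hnull := CantorSystem.sub_mem_meanNull_of_mem_Inf hAB
  obtain ⟨ζ₁, hζ₁, hb₁, hc₁, hcont⟩ := CantorSystem.exists_bijOn_of_meanNull hstab hinf A.isClopen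
    B.isClopen hnull hx₀ hy₀ hw
  have hnull' : (A : Set X)ᶜ.indicator (1 : X → ℤ) - (B : Set X)ᶜ.indicator 1 ∈
      CantorSystem.meanNull X d := by
    rw [Set.indicator_compl, Set.indicator_compl, sub_sub_sub_cancel_left, ← neg_sub]
    exact neg_mem hnull
  -- Excludes the case where exactly one of the two complements is empty.
  have hnot : ∀ C : Set X, IsOpen C → C.Nonempty →
      C.indicator (1 : X → ℤ) ∉ CantorSystem.meanNull X d := by
    intro C hC hne hmem
    obtain ⟨k, hk, hpos⟩ := CantorSystem.exists_card_box_le_boxSum (d := d) hC hne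
    obtain ⟨N, h1, h2⟩ := (hpos.and (CantorSystem.mem_meanNull.1 hmem (2 * k))).exists
    have h3 := h1 x₀
    have h4 := h2 x₀
    have h5 : (0 : ℤ) < (CantorSystem.box d N).card := by
      exact_mod_cast CantorSystem.card_box_pos N
    have h6 := mul_le_mul_of_nonneg_left
      (le_abs_self (CantorSystem.boxSum d N (C.indicator 1) x₀)) (Int.natCast_nonneg k)
    push_cast at h4
    linarith
  have hcompl : ∃ ζ₂ : X → (Fin d → ℤ), Set.BijOn (fun x => ζ₂ x +ᵥ x) (A : Set X)ᶜ (B : Set X)ᶜ ∧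
      ∀ x ∈ (A : Set X)ᶜ, ContinuousAt (fun x => ζ₂ x +ᵥ x) x := by
    rcases (A : Set X)ᶜ.eq_empty_or_nonempty with hA | ⟨a, ha⟩ <;>
      rcases (B : Set X)ᶜ.eq_empty_or_nonempty with hB | hB
    · rw [hA, hB]
      exact ⟨0, Set.bijOn_empty _, by simp⟩
    · rw [hA, Set.indicator_empty', zero_sub] at hnull'
      exact (hnot _ B.isClopen.compl.isOpen hB (neg_mem_iff.1 hnull')).elim
    · rw [hB, Set.indicator_empty', sub_zero] at hnull'
      exact (hnot _ A.isClopen.compl.isOpen ⟨a, ha⟩ hnull').elim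
    -- The gluing needs marked points in one orbit, which density provides. The possible jump of
    -- `ζ₂` at a lies outside A.
    · obtain ⟨b, ⟨v, hv⟩, hb⟩ : ∃ b, b ∈ AddAction.orbit (Fin d → ℤ) a ∧ b ∈ (B : Set X)ᶜ := by
        obtain ⟨b, hb, hb'⟩ := (AddAction.dense_orbit (Fin d → ℤ) a).inter_open_nonempty _
          B.isClopen.compl.isOpen hB
        exact ⟨b, hb', hb⟩
      obtain ⟨ζ₂, -, hb₂, hc₂, -⟩ := CantorSystem.exists_bijOn_of_meanNull hstab hinf
        A.isClopen.compl B.isClopen.compl hnull' ha hb hv.symm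
      exact ⟨ζ₂, hb₂, hc₂⟩
  obtain ⟨ζ₂, hb₂, hc₂⟩ := hcompl
  set ζ : X → (Fin d → ℤ) := (A : Set X).piecewise ζ₁ ζ₂ with hζ
  have e1 : ∀ x ∈ (A : Set X), ζ x = ζ₁ x := fun x hx => Set.piecewise_eq_of_mem _ _ _ hx
  have e2 : ∀ x ∈ (A : Set X)ᶜ, ζ x = ζ₂ x := fun x hx => Set.piecewise_eq_of_notMem _ _ _ hx
  have hB1 : Set.BijOn (fun x => ζ x +ᵥ x) (A : Set X) B :=
    hb₁.congr fun x hx => by simp only [e1 x hx]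
  have hB2 : Set.BijOn (fun x => ζ x +ᵥ x) (A : Set X)ᶜ (B : Set X)ᶜ :=
    hb₂.congr fun x hx => by simp only [e2 x hx]
  have hcts : Continuous fun x => ζ x +ᵥ x := by
    refine continuous_iff_continuousAt.2 fun x => ?_
    by_cases hx : x ∈ (A : Set X)
    · refine (hc₁ x hx).congr ?_
      filter_upwards [A.isClopen.isOpen.mem_nhds hx] with y hy
      rw [e1 y hy]
    · refine (hc₂ x hx).congr ?_
      filter_upwards [A.isClopen.compl.isOpen.mem_nhds hx] with y hy
      rw [e2 y hy]
  have hbij : Function.Bijective fun x => ζ x +ᵥ x := by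
    constructor
    · intro x y (hxy : ζ x +ᵥ x = ζ y +ᵥ y)
      by_cases hx : x ∈ (A : Set X) <;> by_cases hy : y ∈ (A : Set X)
      · exact hB1.injOn hx hy hxy
      · exact (hB2.mapsTo hy (hxy ▸ hB1.mapsTo hx)).elim
      · exact (hB2.mapsTo hx (hxy ▸ hB1.mapsTo hy)).elim
      · exact hB2.injOn hx hy hxy
    · intro y
      by_cases hy : y ∈ (B : Set X)
      · obtain ⟨x, -, hx⟩ := hB1.surjOn hy
        exact ⟨x, hx⟩
      · obtain ⟨x, -, hx⟩ := hB2.surjOn hy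
        exact ⟨x, hx⟩
  have hcts' : Continuous (Equiv.ofBijective _ hbij) := hcts
  refine ⟨hcts'.homeoOfEquivCompactToT2, fun x => ⟨ζ x, rfl⟩, hB1.image_eq, ?_, ζ,
    fun x => rfl, ?_⟩
  · show ζ x₀ +ᵥ x₀ = y₀
    rw [e1 x₀ hx₀, hζ₁, hw]
  · exact hcont.congr fun x hx => e1 x hx.1
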